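/- Let $\Phi$ be a reduced crystallographic root system in the real vector space $V=\mathbb{R}\Phi$, with base $\Delta$, positive roots $\Phi^+$, $\Phi^-=-\Phi^+$, and Weyl group $W$, generated by the set $\mathbb{S}$ of simple reflections. Let $\langle\delta\rangle$ be a cyclic group acting on $V$ by linear automorphisms that preserve $\Phi$ and $\Phi^+$; it acts on $W$ accordingly, and $W\rtimes\langle\delta\rangle$ acts on $V$ and on $\Phi$. Let $\ell$ be the length function of $(W,\mathbb{S})$, and put $\ell(w\delta^k)=\ell(w)$ for $w\in W$, $k\in\mathbb{Z}$. For $x\in W\rtimes\langle\delta\rangle$ let $\Phi(x)$ be the set of roots $\gamma$ such that either $x^i(\gamma)\in\Phi^+$ for all $i\in\mathbb{Z}$ or $x^i(\gamma)\in\Phi^-$ for all $i\in\mathbb{Z}$. For $\gamma\in\Phi^{\pm}\setminus\Phi(x)$ let $n_x(\gamma)=\min\{i\geq 1 : x^i(\gamma)\in\Phi^{\mp}\}$, and let $n_x(\gamma)=\infty$ for $\gamma\in\Phi(x)$. The element $x$ is *quasi-convex* if 1. $\Phi(x)=\Phi\cap\mathbb{Z}J$ for some $J\subseteq\Delta$,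 and 2. $n_x(\alpha+\beta)\leq\max\{n_x(\alpha),n_x(\beta)\}$ for all $\alpha,\beta\in\Phi^+$ with $\alpha+\beta\in\Phi^+$; it is *convex* if both $x$ and $x^{-1}$ are quasi-convex. It is *elliptic* if it fixes no non-zero vector of $V$. Write $x\to x'$ if there are elements $x=x_1,x_2,\dots,x_k=x'$ ($k\geq 1$) of $W\rtimes\langle\delta\rangle$ and simple reflections $s_1,\dots,s_{k-1}$ such that $x_{i+1}=s_ix_is_i$ and $\ell(x_{i+1})\leq\ell(x_i)$ for $1\leq i\leq k-1$. **Proposition.** Let $\mathcal{O}$ be a $W$-conjugacy class in $W\rtimes\langle\delta\rangle$ consisting of elliptic elements, and let $\mathcal{O}_{\min}$ be the set of elements of minimal length in $\mathcal{O}$. Then for every $x\in\mathcal{O}$ there exists $x'\in\mathcal{O}_{\min}$ such that $x'$ is convex and $x\to x'$. -/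

import Mathlib

open scoped SemidirectProduct

noncomputable section

namespace ConvexElements

universe u v w z

/-! Throughout, `P` is the root system `Φ` in `V` with roots `P.root i` (`i : ι`), `b` is the base
`Δ`, the indices in `b.support` are those of the simple roots, and `b.IsPos i` says that `P.root i`
is a positive root. `D` is the cyclic group `⟨δ⟩`, acting on `Φ` through `ρ`. -/

variable {ι : Type u} {V : Type v} {N : Type w} [AddCommGroup V] [Module ℝ V]
  [AddCommGroup N] [Module ℝ N]

/-- The Weyl group is a normal subgroup of the automorphism group of the root system. -/
instance weylGroup_normal (P : RootPairing ι ℝ V N) : P.weylGroup.Normal := by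
  refine ⟨fun n hn g => ?_⟩
  induction hn using RootPairing.weylGroup.induction with
  | one => simp
  | mul x y hx hy hx' hy' =>
    have h : g * (x * y) * g⁻¹ = (g * x * g⁻¹) * (g * y * g⁻¹) := by group
    rw [h]
    exact mul_mem hx' hy'
  | mem i =>
    have h : g * RootPairing.Equiv.reflection P i =
        RootPairing.Equiv.reflection P (RootPairing.Equiv.indexHom P g i) * g := by
      apply RootPairing.Equiv.weightHom_injective P
      rw [map_mul, map_mul]
      ext v
      have h1 : g.weightMap (P.root i) = P.root (g.indexEquiv i) :=
        RootPairing.Hom.root_weightMap_apply P P i g.toHom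
      have h2 : g.coweightMap (P.coroot (g.indexEquiv i)) = P.coroot i := by
        simpa using RootPairing.Hom.coroot_coweightMap_apply P P (g.indexEquiv i) g.toHom
      have h3 : P.toLinearMap (g.weightMap v) (P.coroot (g.indexEquiv i)) =
          P.toLinearMap v (P.coroot i) := by
        rw [← h2]
        exact LinearMap.congr_fun
          (RootPairing.Hom.weight_coweight_transpose_apply P P
            (P.coroot (g.indexEquiv i)) g.toHom) v
      change g.weightMap (P.reflection i v) = P.reflection (g.indexEquiv i) (g.weightMap v)
      rw [RootPairing.reflection_apply, RootPairing.reflection_apply, map_sub, map_smul, h1]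
      congr 2
      exact h3.symm
    rw [h, mul_inv_cancel_right]
    exact RootPairing.reflection_mem_weylGroup P _

variable {P : RootPairing ι ℝ V N} {D : Type z} [Group D]

/-- The action of `D` on the Weyl group `W` induced by its action on the root system. -/
def weylAction (ρ : D →* P.Aut) : D →* MulAut P.weylGroup :=
  (MulAut.conjNormal (H := P.weylGroup)).comp ρ

/-- The extended group `W ⋊ ⟨δ⟩`. -/
abbrev ExtWeyl (ρ : D →* P.Aut) : Type (max u v w z) :=
  P.weylGroup ⋊[weylAction ρ] D

/-- The action of `W ⋊ ⟨δ⟩` on the root system: `w δ ^ k` acts by `w` after `δ ^ k`. -/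
def toAut (ρ : D →* P.Aut) : ExtWeyl ρ →* P.Aut :=
  SemidirectProduct.lift P.weylGroup.subtype ρ (by
    intro d
    ext1 w
    simp [weylAction])

/-- The induced linear action of `W ⋊ ⟨δ⟩` on `V`. -/
def actV (ρ : D →* P.Aut) : ExtWeyl ρ →* (V ≃ₗ[ℝ] V) :=
  (RootPairing.Equiv.weightHom P).comp (toAut ρ)

/-- The induced action of `W ⋊ ⟨δ⟩` on (the index set of) the roots. -/
def actRoot (ρ : D →* P.Aut) : ExtWeyl ρ →* (ι ≃ ι) :=
  (RootPairing.Equiv.indexHom P).comp (toAut ρ)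

/-- The action on indices is the linear action on the roots. -/
theorem root_actRoot (ρ : D →* P.Aut) (x : ExtWeyl ρ) (i : ι) :
    P.root (actRoot ρ x i) = actV ρ x (P.root i) :=
  (RootPairing.Hom.root_weightMap_apply P P i (toAut ρ x).toHom).symm

/-- The reflection in the root with index `i`, as an element of `W ⋊ ⟨δ⟩`. -/
def refl (ρ : D →* P.Aut) (i : ι) : ExtWeyl ρ :=
  SemidirectProduct.inl (RootPairing.weylGroup.ofIdx P i)

/-- The length of `w ∈ W` with respect to the simple reflections: the least length of a word in
simple reflections with product `w`. -/
def weylLength (b : P.Base) (w : P.weylGroup) : ℕ :=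
  sInf {n | ∃ l : List b.support,
    l.length = n ∧ (l.map fun i => RootPairing.weylGroup.ofIdx P i.1).prod = w}

/-- The length function on `W ⋊ ⟨δ⟩`: `ℓ (w δ ^ k) = ℓ w`. -/
def length (b : P.Base) (ρ : D →* P.Aut) (x : ExtWeyl ρ) : ℕ :=
  weylLength b x.left

/-- `Φ(x) = Φ⁺(x) ⊔ Φ⁻(x)`: the roots `γ` such that the `x ^ k (γ)`, `k ∈ ℤ`, are all positive or
all negative. -/
def stableRoots (b : P.Base) (ρ : D →* P.Aut) (x : ExtWeyl ρ) : Set ι :=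
  {i | ∀ k : ℤ, b.IsPos (actRoot ρ (x ^ k) i)} ∪ {i | ∀ k : ℤ, ¬ b.IsPos (actRoot ρ (x ^ k) i)}

/-- `n_x(γ)`: the least `k ≥ 1` such that `γ` and `x ^ k (γ)` have opposite signs. It is `⊤` if
there is no such `k`, that is, if `γ ∈ Φ(x)`. -/
def flipTime (b : P.Base) (ρ : D →* P.Aut) (x : ExtWeyl ρ) (i : ι) : ℕ∞ :=
  sInf {m | ∃ k : ℕ, 1 ≤ k ∧ ¬ (b.IsPos (actRoot ρ (x ^ k) i) ↔ b.IsPos i) ∧ m = k}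

/-- A set of roots is a standard parabolic root subsystem if it is `Φ ∩ ℤJ` for some `J ⊆ Δ`. -/
def IsStandardParabolic (b : P.Base) (R : Set ι) : Prop :=
  ∃ J : Set ι, J ⊆ b.support ∧ R = {i | P.root i ∈ Submodule.span ℤ (P.root '' J)}

/-- Quasi-convex elements of `W ⋊ ⟨δ⟩`. -/
structure IsQuasiConvex (b : P.Base) (ρ : D →* P.Aut) (x : ExtWeyl ρ) : Prop where
  parabolic : IsStandardParabolic b (stableRoots b ρ x)
  flipTime_add_le : ∀ i j k : ι, b.IsPos i → b.IsPos j → b.IsPos k →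
    P.root k = P.root i + P.root j →
    flipTime b ρ x k ≤ max (flipTime b ρ x i) (flipTime b ρ x j)

/-- Convex elements of `W ⋊ ⟨δ⟩`. -/
def IsConvex (b : P.Base) (ρ : D →* P.Aut) (x : ExtWeyl ρ) : Prop :=
  IsQuasiConvex b ρ x ∧ IsQuasiConvex b ρ x⁻¹

/-- An element of `W ⋊ ⟨δ⟩` is elliptic if it fixes no non-zero vector of `V`. -/
def IsElliptic (ρ : D →* P.Aut) (x : ExtWeyl ρ) : Prop :=
  ∀ v : V, actV ρ x v = v → v = 0

/-- `O` is a `W`-conjugacy class in `W ⋊ ⟨δ⟩`. -/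
def IsWConjClass (ρ : D →* P.Aut) (O : Set (ExtWeyl ρ)) : Prop :=
  ∃ x : ExtWeyl ρ, O = {y | ∃ w : P.weylGroup,
    y = SemidirectProduct.inl w * x * (SemidirectProduct.inl w)⁻¹}

/-- The set of elements of minimal length in `O`. -/
def minLength (b : P.Base) (ρ : D →* P.Aut) (O : Set (ExtWeyl ρ)) : Set (ExtWeyl ρ) :=
  {y | y ∈ O ∧ ∀ z ∈ O, length b ρ y ≤ length b ρ z}

/-- One step `x ↦ s x s`, with `s` a simple reflection, that does not increase the length. -/
def CyclicStep (b : P.Base) (ρ : D →* P.Aut) (x y : ExtWeyl ρ) : Prop :=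
  ∃ i ∈ b.support, y = refl ρ i * x * refl ρ i ∧ length b ρ y ≤ length b ρ x

/-- `x → y`: a finite (possibly empty) sequence of such steps leads from `x` to `y`. -/
def CyclicShift (b : P.Base) (ρ : D →* P.Aut) : ExtWeyl ρ → ExtWeyl ρ → Prop :=
  Relation.ReflTransGen (CyclicStep b ρ)

end ConvexElements

end

noncomputable section

namespace ConvexElements

universe u v w z

section Combinatorics

variable {ι : Type u} {V : Type v} {N : Type w} [AddCommGroup V] [Module ℝ V]
  [AddCommGroup N] [Module ℝ N] {P : RootPairing ι ℝ V N} {D : Type z} [Group D]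

/-! ### Signs of roots -/

/-! The root form is an invariant inner product, so `x` acts by an isometry and A = x + x⁻¹ is
symmetric, with eigenvalues ν = 2 cos θ, θ ∈ [0, π]; ellipticity excludes ν = 2. The level of a root
is the largest ν whose eigenspace is not orthogonal to it; it is constant on x-orbits. In good
position (`IsGood`), for each ν a single eigenvector e detects the sign of every root of level ν.

For such x, the sign of xᵐγ is that of aₘ = (xᵐγ, e), and aₘ₊₂ = ν aₘ₊₁ − aₘ: a cosine sampled with
step θ. A periodic solution cannot stay positive unless ν = 2, so Φ(x) is empty (`exists_flip`). In
a sum of two roots the higher level dictates the sign; for equal levels a Casoratian comparison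
applies (`exists_nonpos_of_add`). As A does not distinguish x from x⁻¹, x is convex. Moreover signs
change with frequency θ/π, so averaging over orbits gives 2ℓ(x) as the sum of all θ/π
(`signChanges_eq_sum`), which depends only on the conjugacy class.

Conjugating by W moves the chamber. Crossing a wall does not increase the length unless x and x⁻¹
both keep its simple root positive, and this suffices to move in the direction Av
(`exists_reach_symOp_nonneg`). Instead of following that flow, `exists_reach_eigenvector` minimises
the norm among vectors of reachable chambers with prescribed component in an eigenspace: the
minimiser is an eigenvector. Doing this from the largest eigenvalue downwards, each time by a small
perturbation (`exists_reach_flag`), ends in good position. Every element thus descends to good ones,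
and these all have the same length within the class, so they are of minimal length. -/

theorem root_negIdx (P : RootPairing ι ℝ V N) (i : ι) :
    P.root (P.reflectionPerm i i) = -P.root i := by
  rw [RootPairing.root_reflectionPerm, RootPairing.reflection_apply_self]

theorem isPos_negIdx (b : P.Base) (i : ι) :
    b.IsPos (P.reflectionPerm i i) ↔ ¬ b.IsPos i :=
  RootPairing.Base.IsPos.neg_iff_not b i

theorem actRoot_negIdx (ρ : D →* P.Aut) (x : ExtWeyl ρ) (i : ι) :
    actRoot ρ x (P.reflectionPerm i i) =
      P.reflectionPerm (actRoot ρ x i) (actRoot ρ x i) := by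
  apply P.root.injective
  rw [root_actRoot, root_negIdx, root_negIdx, map_neg, root_actRoot]

theorem actRoot_refl (ρ : D →* P.Aut) (i j : ι) :
    actRoot ρ (refl ρ i) j = P.reflectionPerm i j := by
  simp [actRoot, refl, toAut, RootPairing.weylGroup.ofIdx]

theorem refl_mul_self (ρ : D →* P.Aut) (i : ι) : refl ρ i * refl ρ i = 1 := by
  have h : RootPairing.weylGroup.ofIdx P i * RootPairing.weylGroup.ofIdx P i = 1 := by
    apply Subtype.ext
    change RootPairing.Equiv.reflection P i * RootPairing.Equiv.reflection P i = 1
    nth_rewrite 1 [← RootPairing.Equiv.reflection_inv]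
    exact inv_mul_cancel _
  rw [refl, ← map_mul, h, map_one]

theorem refl_inv (ρ : D →* P.Aut) (i : ι) : (refl ρ i)⁻¹ = refl ρ i :=
  inv_eq_of_mul_eq_one_right (refl_mul_self ρ i)

theorem toAut_eq_one_iff (ρ : D →* P.Aut) (x : ExtWeyl ρ) [P.IsRootSystem] :
    toAut ρ x = 1 ↔ ∀ i, actRoot ρ x i = i := by
  refine ⟨fun h i => by simp [actRoot, h], fun h => ?_⟩
  apply RootPairing.Equiv.weightHom_injective P
  rw [map_one]
  apply LinearEquiv.toLinearMap_injective
  refine LinearMap.ext_on_range (v := P.root) (RootPairing.IsRootSystem.span_root_eq_top) fun i => ?_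
  have := root_actRoot ρ x i
  rw [h] at this
  exact this.symm

/-- A simple reflection permutes the positive roots other than its own; being an involution, it also
reflects positivity. -/
theorem isPos_reflectionPerm_iff [Finite ι] [P.IsCrystallographic] [P.IsReduced] {b : P.Base}
    {i j : ι} (hj : j ∈ b.support) (h1 : i ≠ j) (h2 : i ≠ P.reflectionPerm j j) :
    b.IsPos (P.reflectionPerm j i) ↔ b.IsPos i := by
  constructor
  · intro h
    have := h.reflectionPerm hj (fun e => h2 ((P.reflectionPerm_self j i).symm.trans (by rw [e])))
    rwa [P.reflectionPerm_self] at this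
  · exact fun h => h.reflectionPerm hj h1

/-! ### Counting sign changes -/

/-- The number of roots whose sign is changed by a permutation of the roots. -/
def signChanges (b : P.Base) (σ : ι ≃ ι) : ℕ :=
  {i | ¬ (b.IsPos (σ i) ↔ b.IsPos i)}.ncard

theorem signChanges_inv (b : P.Base) (σ : Equiv.Perm ι) :
    signChanges b σ⁻¹ = signChanges b σ := by
  unfold signChanges
  rw [← Set.ncard_image_of_injective {i | ¬ (b.IsPos (σ i) ↔ b.IsPos i)} σ.injective,
    Equiv.image_eq_preimage_symm]
  congr 1
  ext i
  simp only [Set.mem_ofPred_eq, Set.mem_preimage, Equiv.apply_symm_apply]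
  exact not_congr iff_comm

/-- After reindexing by the reflection, the two sets of sign-changing roots can differ only at the
simple root and its negative. -/
theorem signChanges_actRoot_mul_refl [Finite ι] [P.IsCrystallographic] [P.IsReduced]
    (b : P.Base) (ρ : D →* P.Aut) (x : ExtWeyl ρ) {j : ι} (hj : j ∈ b.support) :
    (¬ b.IsPos (actRoot ρ x j) →
      signChanges b (actRoot ρ (x * refl ρ j)) + 2 = signChanges b (actRoot ρ x)) ∧
    (b.IsPos (actRoot ρ x j) →
      signChanges b (actRoot ρ (x * refl ρ j)) = signChanges b (actRoot ρ x) + 2) := by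
  set n := P.reflectionPerm j j with hn
  have hjp : b.IsPos j := RootPairing.Base.isPos_of_mem_support hj
  have hnp : ¬ b.IsPos n := by rw [hn, isPos_negIdx]; exact not_not.2 hjp
  have hjn : j ≠ n := fun h => hnp (h ▸ hjp)
  have hsn : P.reflectionPerm j n = j := by rw [hn, P.reflectionPerm_self]
  have hxn : b.IsPos (actRoot ρ x n) ↔ ¬ b.IsPos (actRoot ρ x j) := by
    rw [hn, actRoot_negIdx, isPos_negIdx]
  have h0 : signChanges b (actRoot ρ (x * refl ρ j)) =
      {i | ¬ (b.IsPos (actRoot ρ x i) ↔ b.IsPos (P.reflectionPerm j i))}.ncard := by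
    unfold signChanges
    rw [← Set.ncard_image_of_injective _ (P.reflectionPerm j).injective,
      Equiv.image_eq_preimage_symm]
    congr 1
    ext i
    simp [actRoot_refl]
  rw [h0, signChanges]
  have hcard : ({j, n} : Set ι).ncard = 2 := Set.ncard_pair hjn
  have hoff : ∀ i, i ≠ j → i ≠ n → (b.IsPos (P.reflectionPerm j i) ↔ b.IsPos i) :=
    fun i h1 h2 => isPos_reflectionPerm_iff hj h1 h2
  constructor
  · intro hx
    rw [← hcard, ← Set.ncard_union_eq _ (Set.toFinite _) (Set.toFinite _)]
    · congr 1
      ext i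
      by_cases h1 : i = j
      · subst h1; simp [hx, hjp]
      by_cases h2 : i = n
      · subst h2; simp [hxn, hx, hnp]
      simp [h1, h2, hoff i h1 h2]
    · rw [Set.disjoint_left]
      rintro i hi (rfl | rfl)
      · exact hi (by simp [hx, ← hn, hnp])
      · exact hi (by simp [hxn, hx, hsn, hjp])
  · intro hx
    rw [← hcard, ← Set.ncard_union_eq _ (Set.toFinite _) (Set.toFinite _)]
    · congr 1
      ext i
      by_cases h1 : i = j
      · subst h1; simp [hx, ← hn, hnp]
      by_cases h2 : i = n
      · subst h2; simp [hxn, hx, hsn, hjp]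
      simp [h1, h2, hoff i h1 h2]
    · rw [Set.disjoint_left]
      rintro i hi (rfl | rfl)
      · exact hi (by simp [hx, hjp])
      · exact hi (by simp [hxn, hx, hnp])

theorem signChanges_actRoot_refl_mul_le [Finite ι] [P.IsCrystallographic] [P.IsReduced]
    (b : P.Base) (ρ : D →* P.Aut) (x : ExtWeyl ρ) {j : ι} (hj : j ∈ b.support) :
    signChanges b (actRoot ρ (refl ρ j * x)) ≤ signChanges b (actRoot ρ x) + 2 := by
  have h := signChanges_actRoot_mul_refl b ρ x⁻¹ hj
  rw [← signChanges_inv b (actRoot ρ x), ← signChanges_inv b (actRoot ρ (refl ρ j * x)),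
    ← map_inv, ← map_inv, mul_inv_rev, refl_inv]
  by_cases hx : b.IsPos (actRoot ρ x⁻¹ j)
  · exact (h.2 hx).le
  · have := h.1 hx
    omega

/-- One of the two multiplications removes two sign changes and the other adds at most two. This is
the criterion for crossing a wall. -/
theorem signChanges_conj_refl_le [Finite ι] [P.IsCrystallographic] [P.IsReduced]
    (b : P.Base) (ρ : D →* P.Aut) (x : ExtWeyl ρ) {j : ι} (hj : j ∈ b.support)
    (hx : ¬ b.IsPos (actRoot ρ x j) ∨ ¬ b.IsPos (actRoot ρ x⁻¹ j)) :
    signChanges b (actRoot ρ (refl ρ j * x * refl ρ j)) ≤ signChanges b (actRoot ρ x) := by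
  have key : ∀ y : ExtWeyl ρ, ¬ b.IsPos (actRoot ρ y j) →
      signChanges b (actRoot ρ (refl ρ j * y * refl ρ j)) ≤ signChanges b (actRoot ρ y) := by
    intro y hy
    have h1 := (signChanges_actRoot_mul_refl b ρ y hj).1 hy
    have h2 := signChanges_actRoot_refl_mul_le b ρ (y * refl ρ j) hj
    rw [mul_assoc]
    omega
  rcases hx with hx | hx
  · exact key x hx
  · have := key x⁻¹ hx
    rw [← signChanges_inv b (actRoot ρ x), ← signChanges_inv b (actRoot ρ (_ * _)),
      ← map_inv, ← map_inv]
    simpa [mul_assoc, refl_inv] using this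

/-! ### The length function -/

/-- The product of a word in simple reflections. -/
def wordProd (b : P.Base) (l : List b.support) : P.weylGroup :=
  (l.map fun i => RootPairing.weylGroup.ofIdx P i.1).prod

theorem wordProd_cons (b : P.Base) (i : b.support) (l : List b.support) :
    wordProd b (i :: l) = RootPairing.weylGroup.ofIdx P i.1 * wordProd b l := by
  simp [wordProd]

theorem ofIdx_mul_self (P : RootPairing ι ℝ V N) (i : ι) :
    RootPairing.weylGroup.ofIdx P i * RootPairing.weylGroup.ofIdx P i = 1 := by
  apply Subtype.ext
  change RootPairing.Equiv.reflection P i * RootPairing.Equiv.reflection P i = 1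
  nth_rewrite 1 [← RootPairing.Equiv.reflection_inv]
  exact inv_mul_cancel _

theorem reflection_reflectionPerm_aut (P : RootPairing ι ℝ V N) (i j : ι) :
    RootPairing.weylGroup.ofIdx P (P.reflectionPerm j i) =
      RootPairing.weylGroup.ofIdx P j * RootPairing.weylGroup.ofIdx P i *
        RootPairing.weylGroup.ofIdx P j := by
  apply Subtype.ext
  apply RootPairing.Equiv.weightHom_injective P
  change RootPairing.Equiv.weightHom P (RootPairing.Equiv.reflection P (P.reflectionPerm j i)) =
    RootPairing.Equiv.weightHom P (RootPairing.Equiv.reflection P j *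
      RootPairing.Equiv.reflection P i * RootPairing.Equiv.reflection P j)
  rw [map_mul, map_mul]
  simp only [RootPairing.Equiv.weightHom_apply, RootPairing.Equiv.reflection_weightEquiv]
  exact P.reflection_reflectionPerm

theorem exists_wordProd_eq [Finite ι] [P.IsCrystallographic] [P.IsReduced]
    (b : P.Base) (w : P.weylGroup) : ∃ l, wordProd b l = w := by
  have hrefl : ∀ i, ∃ l, wordProd b l = RootPairing.weylGroup.ofIdx P i := by
    intro i
    -- Every root arises from simple ones by negation and simple reflections; reflecting the root
    -- conjugates its reflection.
    refine b.induction_reflect i (p := fun i => ∃ l, wordProd b l = RootPairing.weylGroup.ofIdx P i)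
      ?_ ?_ ?_
    · rintro i ⟨l, hl⟩
      refine ⟨l, ?_⟩
      rw [hl, reflection_reflectionPerm_aut, ofIdx_mul_self, one_mul]
    · exact fun i hi => ⟨[⟨i, hi⟩], by simp [wordProd]⟩
    · rintro i j ⟨l, hl⟩ hj
      refine ⟨⟨j, hj⟩ :: (l ++ [⟨j, hj⟩]), ?_⟩
      rw [reflection_reflectionPerm_aut, ← hl]
      simp [wordProd, mul_assoc]
  obtain ⟨w, hw⟩ := w
  induction hw using RootPairing.weylGroup.induction with
  | one => exact ⟨[], rfl⟩
  | mul x y hx hy hx' hy' =>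
    obtain ⟨l1, h1⟩ := hx'
    obtain ⟨l2, h2⟩ := hy'
    exact ⟨l1 ++ l2, by
      have : wordProd b (l1 ++ l2) = wordProd b l1 * wordProd b l2 := by simp [wordProd]
      rw [this, h1, h2]; rfl⟩
  | mem i => exact hrefl i

/-- The Weyl group acting on the index set of the roots. -/
def weylPerm (P : RootPairing ι ℝ V N) : P.weylGroup →* Equiv.Perm ι :=
  (RootPairing.Equiv.indexHom P).comp P.weylGroup.subtype

theorem actRoot_inl (ρ : D →* P.Aut) (w : P.weylGroup) :
    actRoot ρ (SemidirectProduct.inl w) = weylPerm P w := by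
  simp [actRoot, toAut, weylPerm]

theorem weylPerm_ofIdx (P : RootPairing ι ℝ V N) (i : ι) :
    weylPerm P (RootPairing.weylGroup.ofIdx P i) = P.reflectionPerm i := rfl

/-- Deletion: a root made negative by the inverse of a word allows one letter to be removed. -/
theorem exists_wordProd_eq_reflection_mul [Finite ι] [P.IsCrystallographic] [P.IsReduced]
    (b : P.Base) (l : List b.support) (i : ι) (hi : b.IsPos i)
    (h : ¬ b.IsPos (weylPerm P (wordProd b l)⁻¹ i)) :
    ∃ l', l'.length + 1 = l.length ∧
      wordProd b l' = RootPairing.weylGroup.ofIdx P i * wordProd b l := by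
  induction l generalizing i with
  | nil => simp [wordProd, hi] at h
  | cons j l ih =>
    by_cases hij : i = j
    · refine ⟨l, rfl, ?_⟩
      rw [wordProd_cons, hij, ← mul_assoc, ofIdx_mul_self, one_mul]
    · have hinv : (RootPairing.weylGroup.ofIdx P j.1)⁻¹ = RootPairing.weylGroup.ofIdx P j.1 :=
        inv_eq_of_mul_eq_one_right (ofIdx_mul_self P _)
      rw [wordProd_cons, mul_inv_rev, map_mul, hinv, weylPerm_ofIdx, Equiv.Perm.mul_apply] at h
      obtain ⟨l', h1, h2⟩ := ih _ (hi.reflectionPerm j.2 hij) h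
      refine ⟨j :: l', by simp [h1], ?_⟩
      rw [wordProd_cons, h2, reflection_reflectionPerm_aut, wordProd_cons]
      simp only [← mul_assoc, ofIdx_mul_self, one_mul]

theorem signChanges_weylPerm_mul [Finite ι] [P.IsCrystallographic] [P.IsReduced]
    (b : P.Base) (w : P.weylGroup) (j : b.support) :
    (¬ b.IsPos (weylPerm P w⁻¹ j) →
      signChanges b (weylPerm P (RootPairing.weylGroup.ofIdx P j * w)) + 2 =
        signChanges b (weylPerm P w)) ∧
    (b.IsPos (weylPerm P w⁻¹ j) →
      signChanges b (weylPerm P (RootPairing.weylGroup.ofIdx P j * w)) =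
        signChanges b (weylPerm P w) + 2) := by
  -- With a trivial group in place of `D`, the statement for the extended group specialises to W;
  -- inversion turns right multiplication into left.
  have h := signChanges_actRoot_mul_refl b (1 : Unit →* P.Aut) (SemidirectProduct.inl w⁻¹) j.2
  rw [refl, ← map_mul, actRoot_inl, actRoot_inl] at h
  have hinv : (RootPairing.weylGroup.ofIdx P j.1) = (RootPairing.weylGroup.ofIdx P j.1)⁻¹ :=
    (inv_eq_of_mul_eq_one_right (ofIdx_mul_self P _)).symm
  rw [hinv, ← mul_inv_rev, map_inv, signChanges_inv, map_inv, signChanges_inv, ← map_inv] at h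
  exact h

theorem signChanges_wordProd_le [Finite ι] [P.IsCrystallographic] [P.IsReduced]
    (b : P.Base) (l : List b.support) :
    signChanges b (weylPerm P (wordProd b l)) ≤ 2 * l.length := by
  induction l with
  | nil => simp [wordProd, signChanges]
  | cons j l ih =>
    rw [wordProd_cons, List.length_cons]
    have h := signChanges_weylPerm_mul b (wordProd b l) j
    by_cases hp : b.IsPos (weylPerm P (wordProd b l)⁻¹ j)
    · have := h.2 hp
      omega
    · have := h.1 hp
      omega

theorem exists_reduced_word [Finite ι] [P.IsCrystallographic] [P.IsReduced]
    (b : P.Base) (l : List b.support) :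
    ∃ l', wordProd b l' = wordProd b l ∧
      2 * l'.length = signChanges b (weylPerm P (wordProd b l)) := by
  induction l with
  | nil => exact ⟨[], rfl, by simp [wordProd, signChanges]⟩
  | cons j l ih =>
    obtain ⟨l1, h1, h2⟩ := ih
    rw [wordProd_cons]
    have h := signChanges_weylPerm_mul b (wordProd b l) j
    by_cases hp : b.IsPos (weylPerm P (wordProd b l)⁻¹ j)
    · refine ⟨j :: l1, by rw [wordProd_cons, h1], ?_⟩
      rw [h.2 hp, List.length_cons]
      omega
    · obtain ⟨l2, h3, h4⟩ := exists_wordProd_eq_reflection_mul b l1 j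
        (RootPairing.Base.isPos_of_mem_support j.2) (by rwa [h1])
      refine ⟨l2, by rw [h4, h1], ?_⟩
      have := h.1 hp
      omega

/-- The factor 2 appears because `signChanges` counts a root together with its negative. -/
theorem two_mul_weylLength [Finite ι] [P.IsCrystallographic] [P.IsReduced]
    (b : P.Base) (w : P.weylGroup) :
    2 * weylLength b w = signChanges b (weylPerm P w) := by
  obtain ⟨l, rfl⟩ := exists_wordProd_eq b w
  obtain ⟨l', h1, h2⟩ := exists_reduced_word b l
  apply le_antisymm
  · rw [← h2]
    exact Nat.mul_le_mul_left _ (Nat.sInf_le ⟨l', rfl, h1⟩)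
  · obtain ⟨m, hm, hm'⟩ := Nat.sInf_mem (s := {n | ∃ m : List b.support, m.length = n ∧
      (m.map fun i => RootPairing.weylGroup.ofIdx P i.1).prod = wordProd b l}) ⟨_, l', rfl, h1⟩
    rw [weylLength, ← hm, ← hm']
    exact signChanges_wordProd_le b m

/-- The generator `δ` of `D` preserves the positive roots, hence so does `D`. -/
theorem isPos_iff_of_generator [Finite ι] (b : P.Base) (ρ : D →* P.Aut) (δ : D)
    (hgen : Subgroup.zpowers δ = ⊤)
    (hδ : ∀ i, b.IsPos i → b.IsPos (RootPairing.Equiv.indexHom P (ρ δ) i)) (d : D) (i : ι) :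
    b.IsPos (RootPairing.Equiv.indexHom P (ρ d) i) ↔ b.IsPos i := by
  have h1 : ∀ i, b.IsPos (RootPairing.Equiv.indexHom P (ρ δ) i) ↔ b.IsPos i := by
    intro i
    refine ⟨fun h => ?_, hδ i⟩
    by_contra hi
    rw [← isPos_negIdx] at hi
    have h2 := hδ _ hi
    have h3 := actRoot_negIdx ρ (SemidirectProduct.inr δ) i
    simp only [actRoot, toAut, MonoidHom.comp_apply, SemidirectProduct.lift_inr] at h3
    rw [h3, isPos_negIdx] at h2
    exact h2 h
  have hd : d ∈ Subgroup.zpowers δ := hgen ▸ Subgroup.mem_top d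
  obtain ⟨n, rfl⟩ := Subgroup.mem_zpowers_iff.1 hd
  clear hd
  induction n using Int.induction_on generalizing i with
  | zero => simp
  | succ n ih =>
    rw [zpow_add_one, map_mul, map_mul]
    exact (ih _).trans (h1 i)
  | pred n ih =>
    rw [zpow_sub_one, map_mul, map_mul]
    refine (ih _).trans ?_
    rw [← h1 (RootPairing.Equiv.indexHom P (ρ δ⁻¹) i), ← Equiv.Perm.mul_apply, ← map_mul,
      ← map_mul, mul_inv_cancel, map_one, map_one]
    rfl

/-- The component in `D` preserves signs, so only the Weyl group component contributes. -/
theorem two_mul_length [Finite ι] [P.IsCrystallographic] [P.IsReduced]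
    (b : P.Base) (ρ : D →* P.Aut)
    (hD : ∀ d i, b.IsPos (RootPairing.Equiv.indexHom P (ρ d) i) ↔ b.IsPos i) (x : ExtWeyl ρ) :
    2 * length b ρ x = signChanges b (actRoot ρ x) := by
  rw [length, two_mul_weylLength]
  have h : actRoot ρ x = weylPerm P x.left * RootPairing.Equiv.indexHom P (ρ x.right) := by
    conv_lhs => rw [← SemidirectProduct.inl_left_mul_inr_right x]
    rw [map_mul, actRoot_inl]
    simp [actRoot, toAut]
  rw [h]
  unfold signChanges
  rw [← Set.ncard_image_of_injective _ (RootPairing.Equiv.indexHom P (ρ x.right))⁻¹.injective]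
  congr 1
  ext i
  have h1 := (RootPairing.Equiv.indexHom P (ρ x.right)).apply_symm_apply
  have h2 := (RootPairing.Equiv.indexHom P (ρ x.right)).symm_apply_apply
  rw [Set.mem_image]
  constructor
  · rintro ⟨k, hk, rfl⟩
    rw [Set.mem_ofPred_eq, Equiv.Perm.mul_apply,
      ← hD x.right ((RootPairing.Equiv.indexHom P (ρ x.right))⁻¹ k)]
    have h3 : RootPairing.Equiv.indexHom P (ρ x.right)
        ((RootPairing.Equiv.indexHom P (ρ x.right))⁻¹ k) = k := h1 k
    rwa [h3]
  · intro hi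
    refine ⟨RootPairing.Equiv.indexHom P (ρ x.right) i, ?_, h2 i⟩
    rw [Set.mem_ofPred_eq, hD]
    exact hi

end Combinatorics

/-! ### Sequences with a second order recurrence -/

theorem casoratian_const {ν : ℝ} {a c : ℕ → ℝ} (ha : ∀ m, a (m + 2) = ν * a (m + 1) - a m)
    (hc : ∀ m, c (m + 2) = ν * c (m + 1) - c m) (m : ℕ) :
    a m * c (m + 1) - a (m + 1) * c m = a 0 * c 1 - a 1 * c 0 := by
  induction m with
  | zero => rfl
  | succ m ih => rw [← ih, ha, hc]; ring

/-- If `c` becomes nonpositive no later than `a`, then `c` is ahead of `a`. -/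
theorem casoratian_neg {ν : ℝ} {a c : ℕ → ℝ} (ha : ∀ m, a (m + 2) = ν * a (m + 1) - a m)
    (hc : ∀ m, c (m + 2) = ν * c (m + 1) - c m) {m : ℕ} (hm : c m ≤ 0)
    (hpos : ∀ k ≤ m, 0 < a k) (hc0 : 0 < c 0) : a 0 * c 1 - a 1 * c 0 < 0 := by
  classical
  have hex : ∃ k, c k ≤ 0 := ⟨m, hm⟩
  obtain ⟨k, hk⟩ : ∃ k, Nat.find hex = k + 1 := by
    refine Nat.exists_eq_succ_of_ne_zero fun h0 => ?_
    have := Nat.find_spec hex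
    rw [h0] at this
    linarith
  have h1 : c (k + 1) ≤ 0 := hk ▸ Nat.find_spec hex
  have h2 : 0 < c k := not_le.1 (Nat.find_min hex (by omega))
  have hle : k + 1 ≤ m := hk ▸ Nat.find_le hm
  -- The Casoratian is evaluated at the first drop of c, where c k > 0 ≥ c (k + 1) while a is still
  -- positive.
  rw [← casoratian_const ha hc k]
  have := mul_nonneg (hpos k (by omega)).le (neg_nonneg.2 h1)
  have := mul_pos (hpos (k + 1) hle) h2
  linarith

/-- A sum of two solutions with positive initial value does not stay positive longer than both
summands. -/
theorem exists_nonpos_of_add {ν : ℝ} {a c : ℕ → ℝ} (ha : ∀ m, a (m + 2) = ν * a (m + 1) - a m)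
    (hc : ∀ m, c (m + 2) = ν * c (m + 1) - c m) {p q : ℕ} (hp : a p ≤ 0) (hq : c q ≤ 0)
    (ha0 : 0 < a 0) (hc0 : 0 < c 0) : ∃ k ≤ max p q, a k + c k ≤ 0 := by
  by_contra! h
  have hs : ∀ m, (a + c) (m + 2) = ν * (a + c) (m + 1) - (a + c) m := by
    intro m
    simp only [Pi.add_apply, ha, hc]
    ring
  -- The Casoratians of a + c with a and with c are opposite numbers, so they cannot both be
  -- negative.
  have h1 := casoratian_neg hs ha hp (fun k hk => h k (hk.trans (le_max_left _ _))) ha0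
  have h2 := casoratian_neg hs hc hq (fun k hk => h k (hk.trans (le_max_right _ _))) hc0
  simp only [Pi.add_apply] at h1 h2
  linarith

/-- A positive bounded solution forces the characteristic root `1`. -/
theorem recurrence_eq_two {ν : ℝ} {a : ℕ → ℝ} (ha : ∀ m, a (m + 2) = ν * a (m + 1) - a m)
    {n : ℕ} (hn : 0 < n) (hper : ∀ m, a (m + n) = a m) (hpos : ∀ m, 0 < a m) : ν = 2 := by
  have hsum : ∀ k, ∑ m ∈ Finset.range n, a (m + k) = ∑ m ∈ Finset.range n, a m := by
    intro k
    induction k with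
    | zero => rfl
    | succ k ih =>
      rw [← ih]
      have h1 := Finset.sum_range_succ (fun m => a (m + k)) n
      have h2 := Finset.sum_range_succ' (fun m => a (m + k)) n
      simp only [zero_add] at h2
      rw [h1, show n + k = k + n by ring, hper] at h2
      have h3 : ∀ m, a (m + (k + 1)) = a (m + 1 + k) := fun m => by congr 1; ring
      simp only [h3]
      linarith
  have hS : 0 < ∑ m ∈ Finset.range n, a m :=
    Finset.sum_pos (fun m _ => hpos m) ⟨0, Finset.mem_range.2 hn⟩
  have h : ∑ m ∈ Finset.range n, a (m + 2) =
      ν * ∑ m ∈ Finset.range n, a (m + 1) - ∑ m ∈ Finset.range n, a m := by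
    rw [Finset.mul_sum, ← Finset.sum_sub_distrib]
    exact Finset.sum_congr rfl fun m _ => ha m
  -- All shifted sums over a period equal the same S > 0, so the recurrence reads S = νS − S.
  rw [hsum, hsum] at h
  have : (ν - 2) * ∑ m ∈ Finset.range n, a m = 0 := by linarith
  rcases mul_eq_zero.1 this with h | h
  · linarith
  · exact absurd h hS.ne'

theorem exists_cos_form {θ : ℝ} (hθ : Real.sin θ ≠ 0) {a : ℕ → ℝ}
    (ha : ∀ m, a (m + 2) = 2 * Real.cos θ * a (m + 1) - a m) :
    ∃ r φ : ℝ, 0 ≤ r ∧ ∀ m : ℕ, a m = r * Real.cos (φ + m * θ) := by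
  -- Solving a 0 = r cos φ and a 1 = r cos (φ + θ) gives B = r sin φ, so r and φ are the polar
  -- coordinates of a 0 + iB.
  set B := (a 0 * Real.cos θ - a 1) / Real.sin θ with hB
  set z : ℂ := ⟨a 0, B⟩ with hz
  refine ⟨‖z‖, z.arg, norm_nonneg _, ?_⟩
  have hre : ‖z‖ * Real.cos z.arg = a 0 := Complex.norm_mul_cos_arg z
  have him : ‖z‖ * Real.sin z.arg = B := Complex.norm_mul_sin_arg z
  have key : ∀ m : ℕ, a m = ‖z‖ * Real.cos (z.arg + m * θ) ∧
      a (m + 1) = ‖z‖ * Real.cos (z.arg + (m + 1 : ℕ) * θ) := by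
    intro m
    induction m with
    | zero =>
      refine ⟨by simp [hre], ?_⟩
      simp only [zero_add, Nat.cast_one, one_mul, Real.cos_add, mul_sub, ← mul_assoc, hre, him]
      rw [hB]
      field_simp
      ring
    | succ m ih =>
      refine ⟨ih.2, ?_⟩
      rw [ha, ih.1, ih.2]
      have e1 : z.arg + ((m + 1 + 1 : ℕ) : ℝ) * θ = (z.arg + ((m + 1 : ℕ) : ℝ) * θ) + θ := by
        push_cast; ring
      have e2 : z.arg + (m : ℝ) * θ = (z.arg + ((m + 1 : ℕ) : ℝ) * θ) - θ := by
        push_cast; ring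
      rw [e1, e2]
      generalize z.arg + ((m + 1 : ℕ) : ℝ) * θ = t
      rw [Real.cos_add, Real.cos_sub]
      ring
  exact fun m => (key m).1

/-- The floor n satisfies |t − nπ| ≤ π/2, hence (−1)ⁿ cos t ≥ 0. -/
theorem cos_pos_iff_even_floor {t : ℝ} (ht : Real.cos t ≠ 0) :
    0 < Real.cos t ↔ Even ⌊t / Real.pi + 1 / 2⌋ := by
  set n := ⌊t / Real.pi + 1 / 2⌋ with hn
  have h1 : (n : ℝ) ≤ t / Real.pi + 1 / 2 := Int.floor_le _
  have h2 : t / Real.pi + 1 / 2 < n + 1 := Int.lt_floor_add_one _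
  have hpi := Real.pi_pos
  have ht' : t = t / Real.pi * Real.pi := by field_simp
  have h3 : -(Real.pi / 2) ≤ t - n * Real.pi := by nlinarith
  have h4 : t - n * Real.pi ≤ Real.pi / 2 := by nlinarith
  have h5 : 0 ≤ Real.cos (t - n * Real.pi) := Real.cos_nonneg_of_neg_pi_div_two_le_of_le h3 h4
  rw [Real.cos_sub_int_mul_pi] at h5
  rcases Int.even_or_odd n with h | h
  · rw [h.neg_one_zpow, one_mul] at h5
    exact ⟨fun _ => h, fun _ => lt_of_le_of_ne h5 ht.symm⟩
  · rw [h.neg_one_zpow] at h5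
    refine ⟨fun h' => by linarith, fun h' => absurd h' (Int.not_even_iff_odd.2 h)⟩

/-- The number of sign changes of a nowhere vanishing solution grows linearly. -/
theorem card_sign_changes_bound {θ : ℝ} (h0 : 0 ≤ θ) (h1 : θ ≤ Real.pi) (r φ : ℝ) (hr : 0 ≤ r)
    {a : ℕ → ℝ} (ha : ∀ m : ℕ, a m = r * Real.cos (φ + m * θ)) (hne : ∀ m, a m ≠ 0) (q : ℕ) :
    |(∑ m ∈ Finset.range q, if (0 < a (m + 1) ↔ 0 < a m) then (0 : ℝ) else 1) -
      q * (θ / Real.pi)| ≤ 1 := by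
  have hpi := Real.pi_pos
  have hr' : 0 < r := lt_of_le_of_ne hr fun h => hne 0 (by rw [ha, ← h, zero_mul])
  set f : ℕ → ℤ := fun m => ⌊(φ + m * θ) / Real.pi + 1 / 2⌋ with hf
  have hpos : ∀ m, 0 < a m ↔ Even (f m) := by
    intro m
    rw [ha, mul_pos_iff_of_pos_left hr', hf]
    exact cos_pos_iff_even_floor fun h => hne m (by rw [ha, h, mul_zero])
  have hstep : ∀ m, f (m + 1) = f m ∨ f (m + 1) = f m + 1 := by
    intro m
    have e : (φ + ((m + 1 : ℕ) : ℝ) * θ) / Real.pi + 1 / 2 =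
        (φ + m * θ) / Real.pi + 1 / 2 + θ / Real.pi := by
      push_cast; ring
    have g1 : 0 ≤ θ / Real.pi := div_nonneg h0 hpi.le
    have g2 : θ / Real.pi ≤ 1 := (div_le_one hpi).2 h1
    have u1 : f m ≤ f (m + 1) := Int.floor_le_floor (by rw [e]; linarith)
    have u2 : f (m + 1) ≤ f m + 1 := by
      rw [hf]
      simp only
      rw [← Int.floor_add_one]
      exact Int.floor_le_floor (by rw [e]; linarith)
    omega
  -- Since 0 ≤ θ/π ≤ 1, the floor advances by 0 or 1, and by 1 exactly at a sign change; the count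
  -- therefore telescopes.
  have hterm : ∀ m, (if (0 < a (m + 1) ↔ 0 < a m) then (0 : ℝ) else 1) = f (m + 1) - f m := by
    intro m
    simp only [hpos]
    rcases hstep m with h | h
    · simp [h]
    · rw [if_neg (by rw [h, Int.even_add_one]; tauto), h]
      push_cast; ring
  rw [Finset.sum_congr rfl fun m _ => hterm m, Finset.sum_range_sub (fun m => (f m : ℝ))]
  have f1 := Int.floor_le ((φ + (q : ℝ) * θ) / Real.pi + 1 / 2)
  have f2 := Int.lt_floor_add_one ((φ + (q : ℝ) * θ) / Real.pi + 1 / 2)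
  have f3 := Int.floor_le ((φ + ((0 : ℕ) : ℝ) * θ) / Real.pi + 1 / 2)
  have f4 := Int.lt_floor_add_one ((φ + ((0 : ℕ) : ℝ) * θ) / Real.pi + 1 / 2)
  have e : (φ + (q : ℝ) * θ) / Real.pi + 1 / 2 =
      (φ + ((0 : ℕ) : ℝ) * θ) / Real.pi + 1 / 2 + q * (θ / Real.pi) := by
    push_cast; ring
  simp only [hf]
  rw [abs_le]
  constructor <;> linarith

/-! ### Symmetric operators -/

section SymmetricOperators

variable {E : Type*} [NormedAddCommGroup E] [InnerProductSpace ℝ E]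

theorem inner_eq_zero_of_eigen {A : E →ₗ[ℝ] E} (hA : A.IsSymmetric) {μ ν : ℝ} (h : μ ≠ ν)
    {u v : E} (hu : A u = μ • u) (hv : A v = ν • v) : inner ℝ u v = 0 := by
  have := hA u v
  rw [hu, hv, inner_smul_left, inner_smul_right] at this
  have h' : (μ - ν) * inner ℝ u v = 0 := by
    simp only [conj_trivial] at this
    linarith
  exact (mul_eq_zero.1 h').resolve_left (sub_ne_zero.2 h)

/-- The Rayleigh quotient is at most `a` on the orthogonal complement of the eigenspaces with
eigenvalues `> a`, with equality only on the eigenspace of `a`. -/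
theorem rayleigh_le [FiniteDimensional ℝ E] {A : E →ₗ[ℝ] E} (hA : A.IsSymmetric) {a : ℝ} {v : E}
    (hv : ∀ ν > a, ∀ y, A y = ν • y → inner ℝ v y = 0) (hne : A v ≠ a • v) :
    inner ℝ (A v - a • v) v < 0 := by
  set B := hA.eigenvectorBasis rfl with hB
  set l := hA.eigenvalues rfl with hl
  have hAB : ∀ i, A (B i) = l i • B i := fun i => hA.apply_eigenvectorBasis rfl i
  have hc : ∀ i, inner ℝ (A v - a • v) (B i) = (l i - a) * inner ℝ v (B i) := by
    intro i
    rw [inner_sub_left, hA, hAB, inner_smul_right, inner_smul_left, conj_trivial]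
    ring
  -- In an eigenbasis each term is (l i − a)(v, B i)², and the terms with l i > a vanish by
  -- hypothesis.
  have hterm : ∀ i, inner ℝ (A v - a • v) (B i) * inner ℝ (B i) v ≤ 0 := by
    intro i
    rw [hc, real_inner_comm v (B i), mul_assoc]
    by_cases hi : a < l i
    · rw [hv _ hi _ (hAB i)]; simp
    · exact mul_nonpos_of_nonpos_of_nonneg (by linarith [not_lt.1 hi]) (mul_self_nonneg _)
  rw [← B.sum_inner_mul_inner]
  refine lt_of_le_of_ne (Finset.sum_nonpos fun i _ => hterm i) fun h0 => hne ?_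
  have h1 := (Finset.sum_eq_zero_iff_of_nonpos fun i _ => hterm i).1 h0
  rw [← sub_eq_zero]
  rw [← inner_self_eq_zero (𝕜 := ℝ), ← B.sum_inner_mul_inner]
  refine Finset.sum_eq_zero fun i hi => ?_
  have h2 := h1 i hi
  have h3 : inner ℝ (A v - a • v) (B i) = 0 := by
    rcases mul_eq_zero.1 h2 with h2 | h2
    · exact h2
    · rw [hc, real_inner_comm, h2, mul_zero]
  rw [h3, zero_mul]

end SymmetricOperators

/-! ### Sign lemmas for small perturbations -/

theorem eventually_add_mul_pos {α β : ℝ} (h : 0 < α ∨ α = 0 ∧ 0 < β) :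
    ∀ᶠ t in nhdsWithin (0 : ℝ) (Set.Ioi 0), 0 < α + t * β := by
  rcases h with h | ⟨rfl, h⟩
  · refine Filter.Eventually.filter_mono nhdsWithin_le_nhds ?_
    have : Filter.Tendsto (fun t : ℝ => α + t * β) (nhds 0) (nhds (α + 0 * β)) :=
      Continuous.tendsto (by fun_prop) 0
    rw [zero_mul, add_zero] at this
    exact this.eventually (lt_mem_nhds h)
  · filter_upwards [self_mem_nhdsWithin] with t ht
    rw [zero_add]
    exact mul_pos ht h

theorem eventually_add_mul_nonneg {α β : ℝ} (h : 0 ≤ α) (h' : α = 0 → 0 ≤ β) :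
    ∀ᶠ t in nhdsWithin (0 : ℝ) (Set.Ioi 0), 0 ≤ α + t * β := by
  rcases h.lt_or_eq with h1 | h1
  · exact (eventually_add_mul_pos (Or.inl h1)).mono fun t ht => ht.le
  · filter_upwards [self_mem_nhdsWithin] with t ht
    rw [← h1, zero_add]
    exact mul_nonneg (le_of_lt ht) (h' h1.symm)

theorem eventually_add_mul_ne_zero {α β : ℝ} (h : β ≠ 0) :
    ∀ᶠ t in nhdsWithin (0 : ℝ) (Set.Ioi 0), α + t * β ≠ 0 := by
  by_cases hp : 0 < α ∨ α = 0 ∧ 0 < β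
  · exact (eventually_add_mul_pos hp).mono fun t ht => ht.ne'
  · have : 0 < -α ∨ -α = 0 ∧ 0 < -β := by
      rcases lt_trichotomy α 0 with h1 | h1 | h1
      · exact Or.inl (by linarith)
      · refine Or.inr ⟨by linarith, ?_⟩
        rcases lt_or_gt_of_ne h with h2 | h2
        · linarith
        · exact absurd (Or.inr ⟨h1, h2⟩) hp
      · exact absurd (Or.inl h1) hp
    refine (eventually_add_mul_pos this).mono fun t ht h0 => ?_
    have : -α + t * -β = -(α + t * β) := by ring
    rw [this, h0] at ht
    simp at ht

/-! ### Isometric actions, the operator x + x⁻¹ and good position -/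

variable {ι : Type u} {E : Type v} {N : Type w} [NormedAddCommGroup E] [InnerProductSpace ℝ E]
  [AddCommGroup N] [Module ℝ N] {P : RootPairing ι ℝ E N} {D : Type z} [Group D]

/-- The extended Weyl group acts by isometries. -/
def ActsByIsometries (ρ : D →* P.Aut) : Prop :=
  ∀ (x : ExtWeyl ρ) (u v : E), inner ℝ (actV ρ x u) (actV ρ x v) = inner ℝ u v

/-- The operator `x + x⁻¹`. -/
def symOp (ρ : D →* P.Aut) (x : ExtWeyl ρ) : E →ₗ[ℝ] E :=
  (actV ρ x).toLinearMap + (actV ρ x⁻¹).toLinearMap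

theorem symOp_apply (ρ : D →* P.Aut) (x : ExtWeyl ρ) (v : E) :
    symOp ρ x v = actV ρ x v + actV ρ x⁻¹ v := rfl

theorem symOp_inv (ρ : D →* P.Aut) (x : ExtWeyl ρ) : symOp ρ x⁻¹ = symOp ρ x := by
  ext v
  rw [symOp_apply, symOp_apply, inv_inv, add_comm]

theorem actV_mul_apply (ρ : D →* P.Aut) (x y : ExtWeyl ρ) (v : E) :
    actV ρ (x * y) v = actV ρ x (actV ρ y v) := by
  rw [map_mul]; rfl

theorem actRoot_mul_apply (ρ : D →* P.Aut) (x y : ExtWeyl ρ) (i : ι) :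
    actRoot ρ (x * y) i = actRoot ρ x (actRoot ρ y i) := by
  rw [map_mul]; rfl

theorem symOp_actV (ρ : D →* P.Aut) (x g : ExtWeyl ρ) (v : E) :
    symOp ρ x (actV ρ g v) = actV ρ g (symOp ρ (g⁻¹ * x * g) v) := by
  rw [symOp_apply, symOp_apply, map_add, ← actV_mul_apply, ← actV_mul_apply, ← actV_mul_apply,
    ← actV_mul_apply]
  congr 3 <;> group

theorem ActsByIsometries.inner_left {ρ : D →* P.Aut} (h : ActsByIsometries ρ) (x : ExtWeyl ρ)
    (u v : E) :
    inner ℝ (actV ρ x u) v = inner ℝ u (actV ρ x⁻¹ v) := by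
  rw [← h x u (actV ρ x⁻¹ v), ← actV_mul_apply, mul_inv_cancel, map_one]
  rfl

theorem ActsByIsometries.isSymmetric {ρ : D →* P.Aut} (h : ActsByIsometries ρ) (x : ExtWeyl ρ) :
    (symOp ρ x).IsSymmetric := by
  intro u v
  rw [symOp_apply, symOp_apply, inner_add_left, inner_add_right, h.inner_left, h.inner_left,
    inv_inv, add_comm]

/-- `ν` is the largest eigenvalue of `A` such that `u` is not orthogonal to the eigenspace. -/
def HasLevel (A : E →ₗ[ℝ] E) (u : E) (ν : ℝ) : Prop :=
  (∀ ν' > ν, ∀ y, A y = ν' • y → inner ℝ u y = 0) ∧ ∃ y, A y = ν • y ∧ inner ℝ u y ≠ 0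

theorem eigen_conj (ρ : D →* P.Aut) (x g : ExtWeyl ρ) {ν : ℝ} {y : E} :
    symOp ρ x (actV ρ g y) = ν • actV ρ g y ↔ symOp ρ (g⁻¹ * x * g) y = ν • y := by
  rw [symOp_actV, ← map_smul]
  exact (actV ρ g).injective.eq_iff

theorem actV_inv_actV (ρ : D →* P.Aut) (g : ExtWeyl ρ) (v : E) :
    actV ρ g (actV ρ g⁻¹ v) = v := by
  rw [← actV_mul_apply, mul_inv_cancel, map_one]; rfl

/-- The isometry g carries the eigenspaces of the conjugate to those of x. So moving the chamber by
g can replace conjugating x. -/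
theorem ActsByIsometries.hasLevel_conj {ρ : D →* P.Aut} (hρ : ActsByIsometries ρ)
    (x g : ExtWeyl ρ) (u : E) (ν : ℝ) :
    HasLevel (symOp ρ x) (actV ρ g u) ν ↔ HasLevel (symOp ρ (g⁻¹ * x * g)) u ν := by
  constructor
  · rintro ⟨h1, y, hy, hy0⟩
    refine ⟨fun ν' hν' z hz => ?_, actV ρ g⁻¹ y, ?_, ?_⟩
    · rw [← hρ g]
      exact h1 ν' hν' _ ((eigen_conj ρ x g).2 hz)
    · rw [← eigen_conj, actV_inv_actV, hy]
    · rwa [← hρ.inner_left]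
  · rintro ⟨h1, y, hy, hy0⟩
    refine ⟨fun ν' hν' z hz => ?_, actV ρ g y, (eigen_conj ρ x g).2 hy, by rwa [hρ g]⟩
    rw [hρ.inner_left]
    refine h1 ν' hν' _ ?_
    rw [← eigen_conj, actV_inv_actV, hz]

/-- The dominant chamber is in good position with respect to `x`. -/
def IsGood (b : P.Base) (ρ : D →* P.Aut) (x : ExtWeyl ρ) : Prop :=
  ∀ ν : ℝ, ∃ e : E, symOp ρ x e = ν • e ∧
    ∀ i, b.IsPos i → HasLevel (symOp ρ x) (P.root i) ν → 0 < inner ℝ (P.root i) e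

/-! ### Moving the chamber -/

/-- The chamber of `g` can be reached from the dominant chamber by cyclic shifts of `x`. -/
def Reach (b : P.Base) (ρ : D →* P.Aut) (x : ExtWeyl ρ) (g : P.weylGroup) : Prop :=
  CyclicShift b ρ x ((SemidirectProduct.inl g)⁻¹ * x * SemidirectProduct.inl g)

theorem root_weylPerm (ρ : D →* P.Aut) (g : P.weylGroup) (i : ι) :
    P.root (weylPerm P g i) = actV ρ (SemidirectProduct.inl g) (P.root i) := by
  rw [← root_actRoot, actRoot_inl]

theorem Reach.mul_ofIdx [Finite ι] [P.IsCrystallographic] [P.IsReduced] {b : P.Base}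
    {ρ : D →* P.Aut} (hD : ∀ d i, b.IsPos (RootPairing.Equiv.indexHom P (ρ d) i) ↔ b.IsPos i)
    {x : ExtWeyl ρ} {g : P.weylGroup} (hg : Reach b ρ x g) {j : ι} (hj : j ∈ b.support)
    (h : ¬ b.IsPos (actRoot ρ ((SemidirectProduct.inl g)⁻¹ * x * SemidirectProduct.inl g) j) ∨
      ¬ b.IsPos (actRoot ρ ((SemidirectProduct.inl g)⁻¹ * x * SemidirectProduct.inl g)⁻¹ j)) :
    Reach b ρ x (g * RootPairing.weylGroup.ofIdx P j) := by
  have e : (SemidirectProduct.inl (g * RootPairing.weylGroup.ofIdx P j))⁻¹ * x *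
      SemidirectProduct.inl (g * RootPairing.weylGroup.ofIdx P j) =
      refl ρ j * ((SemidirectProduct.inl g)⁻¹ * x * SemidirectProduct.inl g) * refl ρ j := by
    rw [map_mul, mul_inv_rev]
    change (refl ρ j)⁻¹ * _ * x * (_ * refl ρ j) = _
    rw [refl_inv]
    simp only [mul_assoc]
  refine Relation.ReflTransGen.tail hg ⟨j, hj, e, ?_⟩
  have h1 := two_mul_length b ρ hD ((SemidirectProduct.inl g)⁻¹ * x * SemidirectProduct.inl g)
  have h2 := two_mul_length b ρ hD ((SemidirectProduct.inl (g * RootPairing.weylGroup.ofIdx P j))⁻¹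
    * x * SemidirectProduct.inl (g * RootPairing.weylGroup.ofIdx P j))
  have h3 := signChanges_conj_refl_le b ρ _ hj h
  rw [← e] at h3
  omega

theorem weylPerm_mul_ofIdx (g : P.weylGroup) (i j : ι) :
    weylPerm P (g * RootPairing.weylGroup.ofIdx P j) i = weylPerm P g (P.reflectionPerm j i) := by
  rw [map_mul]; rfl

theorem root_weylPerm_mul_ofIdx_self (g : P.weylGroup) (j : ι) :
    P.root (weylPerm P (g * RootPairing.weylGroup.ofIdx P j) j) = -P.root (weylPerm P g j) := by
  rw [weylPerm_mul_ofIdx, ← actRoot_inl (1 : Unit →* P.Aut), actRoot_negIdx, root_negIdx]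

theorem weylPerm_injective [P.IsRootSystem] : Function.Injective (weylPerm P) := by
  rw [injective_iff_map_eq_one]
  intro w hw
  have := (toAut_eq_one_iff (1 : Unit →* P.Aut) (SemidirectProduct.inl w)).2
    (fun i => by rw [actRoot_inl, hw]; rfl)
  simpa [toAut] using this

theorem finite_weylGroup [Finite ι] [P.IsRootSystem] : Finite P.weylGroup :=
  Finite.of_injective _ (weylPerm_injective (P := P))

/-- A linear functional which is positive on the simple roots is positive on the positive roots. -/
theorem inner_pos_of_simple [Finite ι] [P.IsCrystallographic] (b : P.Base) (g : P.weylGroup) {q : E}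
    (hq : ∀ j ∈ b.support, 0 < inner ℝ (P.root (weylPerm P g j)) q) {i : ι} (hi : b.IsPos i) :
    0 < inner ℝ (P.root (weylPerm P g i)) q := by
  refine hi.induction_on_add (p := fun i => 0 < inner ℝ (P.root (weylPerm P g i)) q) hq ?_
  intro i j k hk h1 h2
  have := hq j h2
  rw [root_weylPerm (1 : Unit →* P.Aut)] at *
  rw [hk, map_add, inner_add_left]
  exact add_pos h1 this

/-- A generic vector in an open chamber. -/
theorem exists_regular_generic [Finite ι] [P.IsCrystallographic] [P.IsRootSystem]
    [FiniteDimensional ℝ E] (b : P.Base) (g : P.weylGroup) (c : ι → E) :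
    ∃ q : E, (∀ i, b.IsPos i → 0 < inner ℝ (P.root (weylPerm P g i)) q) ∧
      ∀ i, inner ℝ (c i) q = 0 → c i = 0 := by
  let ρ : Unit →* P.Aut := 1
  obtain ⟨q0, hq0⟩ : ∃ q0 : E, ∀ j ∈ b.support, 0 < inner ℝ (P.root (weylPerm P g j)) q0 := by
    -- This functional equals 1 on the g-images of the simple roots; its Riesz vector lies in the
    -- open chamber of g.
    let f : E →ₗ[ℝ] ℝ := (b.toWeightBasis.constr ℝ fun _ => (1 : ℝ)) ∘ₗ
      (actV ρ (SemidirectProduct.inl g)⁻¹).toLinearMap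
    refine ⟨(InnerProductSpace.toDual ℝ E).symm (LinearMap.toContinuousLinearMap f),
      fun j hj => ?_⟩
    rw [real_inner_comm, InnerProductSpace.toDual_symm_apply]
    simp only [LinearMap.coe_toContinuousLinearMap', f, LinearMap.comp_apply, LinearEquiv.coe_coe]
    rw [root_weylPerm ρ, ← actV_mul_apply, inv_mul_cancel, map_one]
    change 0 < (b.toWeightBasis.constr ℝ fun _ => (1 : ℝ)) (P.root j)
    have := b.toWeightBasis.constr_basis ℝ (fun _ => (1 : ℝ)) ⟨j, hj⟩
    rw [b.toWeightBasis_apply] at this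
    rw [this]
    exact one_pos
  -- A vector q1 off all the hyperplanes orthogonal to nonzero c i; a small multiple of it makes q0
  -- generic without leaving the open chamber.
  obtain ⟨q1, hq1⟩ := Module.Dual.exists_forall_ne_zero_of_forall_exists
    (fun i : {i // c i ≠ 0} => (innerₛₗ ℝ (c i) : E →ₗ[ℝ] ℝ))
    (fun i => ⟨c i, by simpa using i.2⟩)
  have h1 : ∀ᶠ t in nhdsWithin (0 : ℝ) (Set.Ioi 0), ∀ j : b.support,
      0 < inner ℝ (P.root (weylPerm P g j)) q0 + t * inner ℝ (P.root (weylPerm P g j)) q1 :=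
    Filter.eventually_all.2 fun j => eventually_add_mul_pos (Or.inl (hq0 j j.2))
  have h2 : ∀ᶠ t in nhdsWithin (0 : ℝ) (Set.Ioi 0), ∀ i : {i // c i ≠ 0},
      inner ℝ (c i) q0 + t * inner ℝ (c i) q1 ≠ 0 :=
    Filter.eventually_all.2 fun i => eventually_add_mul_ne_zero (by simpa using hq1 i)
  obtain ⟨t, ht1, ht2⟩ := (h1.and h2).exists
  refine ⟨q0 + t • q1, fun i hi => inner_pos_of_simple b g (fun j hj => ?_) hi, fun i hi => ?_⟩
  · rw [inner_add_right, inner_smul_right]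
    exact ht1 ⟨j, hj⟩
  · by_contra hc
    rw [inner_add_right, inner_smul_right] at hi
    exact ht2 ⟨i, hc⟩ hi

theorem symOp_commutes (ρ : D →* P.Aut) (x : ExtWeyl ρ) {k : ℤ} {ν : ℝ} {y : E}
    (hy : symOp ρ x y = ν • y) : symOp ρ x (actV ρ (x ^ k) y) = ν • actV ρ (x ^ k) y := by
  rw [symOp_actV, ← map_smul, ← hy]
  congr 3
  group

theorem ActsByIsometries.orthogonal_zpow {ρ : D →* P.Aut} (hρ : ActsByIsometries ρ)
    (x : ExtWeyl ρ) (k : ℤ) {ν : ℝ} {u : E}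
    (hu : ∀ y, symOp ρ x y = ν • y → inner ℝ u y = 0) :
    ∀ y, symOp ρ x y = ν • y → inner ℝ (actV ρ (x ^ k) u) y = 0 := by
  intro y hy
  rw [hρ.inner_left, ← zpow_neg]
  exact hu _ (symOp_commutes ρ x hy)

/-- Among the chambers containing `p` and, to first order, `v`, one can reach a chamber into which
`x + x⁻¹` pushes `v`. -/
theorem exists_reach_symOp_nonneg [Finite ι] [P.IsCrystallographic] [P.IsReduced] [P.IsRootSystem]
    {b : P.Base} {ρ : D →* P.Aut} (hρ : ActsByIsometries ρ)
    (hD : ∀ d i, b.IsPos (RootPairing.Equiv.indexHom P (ρ d) i) ↔ b.IsPos i)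
    {x : ExtWeyl ρ} {a : ℝ} {p : E}
    (hp : ∀ i, inner ℝ (P.root i) p = 0 ↔
      ∀ ν > a, ∀ y, symOp ρ x y = ν • y → inner ℝ (P.root i) y = 0)
    {g₀ : P.weylGroup} {v : E} (hg₀ : Reach b ρ x g₀)
    (hdom : ∀ i, b.IsPos i → 0 ≤ inner ℝ (P.root (weylPerm P g₀ i)) p)
    (hv : ∀ i, b.IsPos i → inner ℝ (P.root (weylPerm P g₀ i)) p = 0 →
      0 ≤ inner ℝ (P.root (weylPerm P g₀ i)) v) :
    ∃ g : P.weylGroup, Reach b ρ x g ∧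
      (∀ i, b.IsPos i → 0 ≤ inner ℝ (P.root (weylPerm P g i)) p) ∧
      (∀ i, b.IsPos i → inner ℝ (P.root (weylPerm P g i)) p = 0 →
        0 ≤ inner ℝ (P.root (weylPerm P g i)) v) ∧
      ∀ i, b.IsPos i → inner ℝ (P.root (weylPerm P g i)) p = 0 →
        inner ℝ (P.root (weylPerm P g i)) v = 0 →
        0 ≤ inner ℝ (P.root (weylPerm P g i)) (symOp ρ x v) := by
  have hfin := finite_weylGroup (P := P)
  -- Among admissible chambers, take one with the fewest positive roots pairing negatively with Av;
  -- crossing a bad wall would lower this number.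
  obtain ⟨g, ⟨h1, h2, h3⟩, hmin⟩ := Set.exists_min_image {g : P.weylGroup | Reach b ρ x g ∧
      (∀ i, b.IsPos i → 0 ≤ inner ℝ (P.root (weylPerm P g i)) p) ∧
      (∀ i, b.IsPos i → inner ℝ (P.root (weylPerm P g i)) p = 0 →
        0 ≤ inner ℝ (P.root (weylPerm P g i)) v)}
    (fun g => {i | b.IsPos i ∧ inner ℝ (P.root (weylPerm P g i)) (symOp ρ x v) < 0}.ncard)
    (Set.toFinite _) ⟨g₀, hg₀, hdom, hv⟩
  refine ⟨g, h1, h2, h3, ?_⟩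
  have hsimple : ∀ j ∈ b.support, inner ℝ (P.root (weylPerm P g j)) p = 0 →
      inner ℝ (P.root (weylPerm P g j)) v = 0 →
      0 ≤ inner ℝ (P.root (weylPerm P g j)) (symOp ρ x v) := by
    intro j hj hjp hjv
    by_contra! hneg
    have hjpos : b.IsPos j := RootPairing.Base.isPos_of_mem_support hj
    set X : ExtWeyl ρ := (SemidirectProduct.inl g)⁻¹ * x * SemidirectProduct.inl g with hX
    have hXk : ∀ k : ℤ, P.root (weylPerm P g (actRoot ρ (X ^ k) j)) =
        actV ρ (x ^ k) (P.root (weylPerm P g j)) := by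
      intro k
      have hXk : X ^ k = (SemidirectProduct.inl g)⁻¹ * x ^ k * SemidirectProduct.inl g := by
        have := conj_zpow (i := k) (a := (SemidirectProduct.inl g : ExtWeyl ρ)⁻¹) (b := x)
        rw [inv_inv] at this
        exact this
      rw [root_weylPerm ρ, root_weylPerm ρ, root_actRoot, ← actV_mul_apply, ← actV_mul_apply, hXk]
      congr 2
      group
    have hkey : ∀ k : ℤ, b.IsPos (actRoot ρ (X ^ k) j) →
        0 ≤ inner ℝ (actV ρ (x ^ k) (P.root (weylPerm P g j))) v := by
      intro k hk
      rw [← hXk]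
      refine h3 _ hk ?_
      rw [hp, hXk]
      exact fun ν hν => hρ.orthogonal_zpow x k ((hp _).1 hjp ν hν)
    -- If both images of the wall root α were positive, both would pair nonnegatively with v, and
    -- their sum gives (α, Av) ≥ 0.
    have hallowed : ¬ b.IsPos (actRoot ρ X j) ∨ ¬ b.IsPos (actRoot ρ X⁻¹ j) := by
      by_contra! hc
      have e1 := hkey 1 (by rw [zpow_one]; exact hc.1)
      have e2 := hkey (-1) (by rw [zpow_neg_one]; exact hc.2)
      rw [zpow_one] at e1
      rw [zpow_neg_one] at e2
      rw [← hρ.isSymmetric x, symOp_apply, inner_add_left] at hneg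
      linarith
    have hg' := h1.mul_ofIdx hD hj hallowed
    set g' := g * RootPairing.weylGroup.ofIdx P j with hg'def
    have hself : P.root (weylPerm P g' j) = -P.root (weylPerm P g j) :=
      root_weylPerm_mul_ofIdx_self g j
    have hother : ∀ i, weylPerm P g' i = weylPerm P g (P.reflectionPerm j i) :=
      fun i => weylPerm_mul_ofIdx g i j
    -- The only positive root affected by the crossing is orthogonal to p and v, so g' remains
    -- admissible.
    have hle := hmin g' ⟨hg', fun i hi => ?_, fun i hi hip => ?_⟩
    · refine absurd hle (not_le.2 ?_)
      rw [← Set.ncard_image_of_injective _ (P.reflectionPerm j).injective]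
      refine Set.ncard_lt_ncard ?_ (Set.toFinite _)
      have hne : ∀ i, inner ℝ (P.root (weylPerm P g' i)) (symOp ρ x v) < 0 → i ≠ j := by
        rintro i hi rfl
        rw [hself, inner_neg_left] at hi
        linarith
      refine ⟨?_, fun hsub => ?_⟩
      · rintro _ ⟨i, ⟨hi1, hi2⟩, rfl⟩
        exact ⟨hi1.reflectionPerm hj (hne i hi2), by rwa [← hother]⟩
      · obtain ⟨i, ⟨hi1, hi2⟩, hi3⟩ := hsub ⟨hjpos, hneg⟩
        have hij : i = P.reflectionPerm j j :=
          (P.reflectionPerm_self j i).symm.trans (by rw [hi3])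
        rw [hij, isPos_negIdx] at hi1
        exact hi1 hjpos
    · by_cases hij : i = j
      · rw [hij, hself, inner_neg_left, hjp, neg_zero]
      · rw [hother]
        exact h2 _ (hi.reflectionPerm hj hij)
    · by_cases hij : i = j
      · rw [hij, hself, inner_neg_left, hjv, neg_zero]
      · rw [hother] at hip ⊢
        exact h3 _ (hi.reflectionPerm hj hij) hip
  intro i hi
  -- Positivity is carried along: when a sum of positive roots pairs to 0 with p and then with v,
  -- nonnegativity forces both summands to do so.
  refine (hi.induction_on_add (p := fun i => b.IsPos i ∧
    (inner ℝ (P.root (weylPerm P g i)) p = 0 → inner ℝ (P.root (weylPerm P g i)) v = 0 →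
        0 ≤ inner ℝ (P.root (weylPerm P g i)) (symOp ρ x v)))
    (fun j hj => ⟨RootPairing.Base.isPos_of_mem_support hj, hsimple j hj⟩) ?_).2
  rintro i j k hk ⟨hi, hi'⟩ hj
  have hjpos : b.IsPos j := RootPairing.Base.isPos_of_mem_support hj
  have hadd : P.root (weylPerm P g k) = P.root (weylPerm P g i) + P.root (weylPerm P g j) := by
    rw [root_weylPerm ρ, root_weylPerm ρ, root_weylPerm ρ, hk, map_add]
  refine ⟨hi.add hjpos hk, fun hkp hkv => ?_⟩
  rw [hadd, inner_add_left] at hkp hkv ⊢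
  have a1 := h2 i hi
  have a2 := h2 j hjpos
  have c1 : inner ℝ (P.root (weylPerm P g i)) p = 0 := by linarith
  have c2 : inner ℝ (P.root (weylPerm P g j)) p = 0 := by linarith
  have a3 := h3 i hi c1
  have a4 := h3 j hjpos c2
  exact add_nonneg (hi' c1 (by linarith)) (hsimple j hj c2 (by linarith))

/-- Starting from a chamber containing `p` in its closure, one can reach a chamber which contains
`p + t • e` for small `t > 0`, where `e` is a generic eigenvector of eigenvalue `a`. -/
theorem exists_reach_eigenvector [Finite ι] [P.IsCrystallographic] [P.IsReduced] [P.IsRootSystem]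
    [FiniteDimensional ℝ E] {b : P.Base} {ρ : D →* P.Aut} (hρ : ActsByIsometries ρ)
    (hD : ∀ d i, b.IsPos (RootPairing.Equiv.indexHom P (ρ d) i) ↔ b.IsPos i)
    {x : ExtWeyl ρ} {a : ℝ} {p : E}
    (hp : ∀ i, inner ℝ (P.root i) p = 0 ↔
      ∀ ν > a, ∀ y, symOp ρ x y = ν • y → inner ℝ (P.root i) y = 0)
    {g₀ : P.weylGroup} (hg₀ : Reach b ρ x g₀)
    (hdom : ∀ i, b.IsPos i → 0 ≤ inner ℝ (P.root (weylPerm P g₀ i)) p) :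
    ∃ (e : E) (g : P.weylGroup), symOp ρ x e = a • e ∧ Reach b ρ x g ∧
      (∀ i, b.IsPos i → 0 ≤ inner ℝ (P.root (weylPerm P g i)) p) ∧
      (∀ i, b.IsPos i → inner ℝ (P.root (weylPerm P g i)) p = 0 →
        0 ≤ inner ℝ (P.root (weylPerm P g i)) e) ∧
      ∀ i, inner ℝ (P.root i) e = 0 → ∀ y, symOp ρ x y = a • y → inner ℝ (P.root i) y = 0 := by
  have hfin := finite_weylGroup (P := P)
  have hA := hρ.isSymmetric x
  set A := symOp ρ x with hAdef
  set K : Submodule ℝ E := Module.End.eigenspace A a with hK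
  set U : Submodule ℝ E := ⨅ ν : Set.Ioi a, (Module.End.eigenspace A ν.1)ᗮ with hU
  have hKmem : ∀ y, y ∈ K ↔ A y = a • y := fun y => Module.End.mem_eigenspace_iff
  have hUmem : ∀ v, v ∈ U ↔ ∀ ν > a, ∀ y, A y = ν • y → inner ℝ v y = 0 := by
    intro v
    simp only [hU, Submodule.mem_iInf, Submodule.mem_orthogonal', Module.End.mem_eigenspace_iff,
      Subtype.forall, Set.mem_Ioi]
  have hKU : K ≤ U := by
    intro y hy
    rw [hUmem]
    intro ν hν z hz
    exact inner_eq_zero_of_eigen hA (ne_of_lt hν) ((hKmem y).1 hy) hz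
  -- Genericity of q makes its projection e to K orthogonal only to roots orthogonal to all of K.
  obtain ⟨q, hq1, hq2⟩ := exists_regular_generic b g₀ fun i => K.starProjection (P.root i)
  set e := K.starProjection q with he
  have heK : e ∈ K := K.starProjection_apply_mem q
  have hqe : ∀ y ∈ K, inner ℝ q y = inner ℝ e y := by
    intro y hy
    rw [← sub_eq_zero, ← inner_sub_left]
    exact K.starProjection_inner_eq_zero q y hy
  have hqU : ∀ y ∈ U, inner ℝ (U.starProjection q) y = inner ℝ q y := by
    intro y hy
    rw [eq_comm, ← sub_eq_zero, ← inner_sub_left]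
    exact U.starProjection_inner_eq_zero q y hy
  let W : P.weylGroup → E → Prop := fun g v => Reach b ρ x g ∧
    (∀ i, b.IsPos i → 0 ≤ inner ℝ (P.root (weylPerm P g i)) p) ∧
    (∀ i, b.IsPos i → inner ℝ (P.root (weylPerm P g i)) p = 0 →
      0 ≤ inner ℝ (P.root (weylPerm P g i)) v)
  -- Vectors of U with K-component e lying, to first order at p, in a reachable chamber. Finiteness
  -- of the Weyl group makes this set closed, so it has a point nearest to 0.
  let M : Set E := {v | v ∈ U ∧ (∀ y ∈ K, inner ℝ v y = inner ℝ e y) ∧ ∃ g, W g v}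
  have hne : M.Nonempty := by
    refine ⟨U.starProjection q, U.starProjection_apply_mem q, fun y hy => ?_, g₀, hg₀, hdom,
      fun i hi hip => ?_⟩
    · rw [hqU y (hKU hy), hqe y hy]
    · rw [real_inner_comm, hqU _ ((hUmem _).2 ((hp _).1 hip)), real_inner_comm]
      exact (hq1 i hi).le
  have hclosed : IsClosed M := by
    refine (Submodule.closed_of_finiteDimensional U).inter (IsClosed.inter ?_ ?_)
    · have : {v : E | ∀ y ∈ K, inner ℝ v y = inner ℝ e y} =
          ⋂ y ∈ K, {v : E | inner ℝ v y = inner ℝ e y} := by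
        ext; simp
      change IsClosed {v : E | ∀ y ∈ K, inner ℝ v y = inner ℝ e y}
      rw [this]
      exact isClosed_biInter fun y _ => isClosed_eq (by fun_prop) continuous_const
    · have : {v : E | ∃ g, W g v} = ⋃ g, {v | W g v} := by ext; simp
      change IsClosed {v : E | ∃ g, W g v}
      rw [this]
      refine isClosed_iUnion_of_finite fun g => ?_
      refine isClosed_const.inter (isClosed_const.inter ?_)
      have : {v : E | ∀ i, b.IsPos i → inner ℝ (P.root (weylPerm P g i)) p = 0 →
          0 ≤ inner ℝ (P.root (weylPerm P g i)) v} =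
          ⋂ i, ⋂ (_ : b.IsPos i), ⋂ (_ : inner ℝ (P.root (weylPerm P g i)) p = 0),
            {v : E | 0 ≤ inner ℝ (P.root (weylPerm P g i)) v} := by
        ext; simp
      change IsClosed {v : E | ∀ i, b.IsPos i → inner ℝ (P.root (weylPerm P g i)) p = 0 →
          0 ≤ inner ℝ (P.root (weylPerm P g i)) v}
      rw [this]
      exact isClosed_iInter fun i => isClosed_iInter fun _ => isClosed_iInter fun _ =>
        isClosed_le continuous_const (by fun_prop)
  obtain ⟨v, hvM, hvmin⟩ := hclosed.exists_infDist_eq_dist hne 0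
  have hvle : ∀ y ∈ M, ‖v‖ ≤ ‖y‖ := by
    intro y hy
    have := Metric.infDist_le_dist_of_mem (x := (0 : E)) hy
    rwa [hvmin, dist_zero_left, dist_zero_left] at this
  obtain ⟨hvU, hvK, g₁, hg1, hg2, hg3⟩ := hvM
  have hAv : A v = a • v := by
    by_contra hneq
    obtain ⟨g, h1, h2, h3, h4⟩ := exists_reach_symOp_nonneg hρ hD hp hg1 hg2 hg3
    have hneg := rayleigh_le hA ((hUmem v).1 hvU) hneq
    -- A descent direction: u is orthogonal to K and (u, v) < 0, so v + tu has the same K-component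
    -- and smaller norm for small t > 0.
    set u := A v - a • v with hu
    have huU : u ∈ U := by
      refine U.sub_mem ((hUmem _).2 fun ν hν y hy => ?_) (U.smul_mem _ hvU)
      rw [hA, hy, inner_smul_right, (hUmem v).1 hvU ν hν y hy, mul_zero]
    have huK : ∀ y ∈ K, inner ℝ u y = 0 := by
      intro y hy
      rw [hu, inner_sub_left, hA, (hKmem y).1 hy, inner_smul_right, inner_smul_left]
      simp
    have t1 : ∀ᶠ t in nhdsWithin (0 : ℝ) (Set.Ioi 0), ∀ i, b.IsPos i →
        inner ℝ (P.root (weylPerm P g i)) p = 0 →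
        0 ≤ inner ℝ (P.root (weylPerm P g i)) v + t * inner ℝ (P.root (weylPerm P g i)) u := by
      refine Filter.eventually_all.2 fun i => ?_
      by_cases hi : b.IsPos i ∧ inner ℝ (P.root (weylPerm P g i)) p = 0
      · refine (eventually_add_mul_nonneg (h3 i hi.1 hi.2) fun h0 => ?_).mono fun t ht _ _ => ht
        rw [hu, inner_sub_right, inner_smul_right, h0, mul_zero, sub_zero]
        exact h4 i hi.1 hi.2 h0
      · exact Filter.Eventually.of_forall fun t h5 h6 => absurd ⟨h5, h6⟩ hi
    have t2 : ∀ᶠ t in nhdsWithin (0 : ℝ) (Set.Ioi 0), 0 < -(2 * inner ℝ u v) + t * -(‖u‖ ^ 2) :=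
      eventually_add_mul_pos (Or.inl (by linarith))
    obtain ⟨t, ⟨ht1, ht2⟩, ht0⟩ := ((t1.and t2).and self_mem_nhdsWithin).exists
    have htpos : 0 < t := ht0
    have hmem : v + t • u ∈ M := by
      refine ⟨U.add_mem hvU (U.smul_mem _ huU), fun y hy => ?_, g, h1, h2, fun i hi hip => ?_⟩
      · rw [inner_add_left, inner_smul_left, huK y hy, mul_zero, add_zero, hvK y hy]
      · rw [inner_add_right, inner_smul_right]
        exact ht1 i hi hip
    have hle := hvle _ hmem
    have hsq := norm_add_sq_real v (t • u)
    rw [inner_smul_right, norm_smul, Real.norm_of_nonneg htpos.le, real_inner_comm] at hsq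
    have h5 : ‖v‖ ^ 2 ≤ ‖v + t • u‖ ^ 2 := pow_le_pow_left₀ (norm_nonneg _) hle 2
    have h6 := mul_pos htpos ht2
    nlinarith
  have hve : v = e := by
    rw [← sub_eq_zero, ← inner_self_eq_zero (𝕜 := ℝ), inner_sub_left, sub_eq_zero]
    exact hvK _ (K.sub_mem ((hKmem v).2 hAv) heK)
  rw [hve] at hAv hg3
  refine ⟨e, g₁, hAv, hg1, hg2, hg3, fun i hi y hy => ?_⟩
  have h0 : K.starProjection (P.root i) = 0 := by
    refine hq2 i ?_
    rw [K.inner_starProjection_left_eq_right]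
    exact hi
  have := K.starProjection_inner_eq_zero (P.root i) y ((hKmem y).2 hy)
  rwa [h0, sub_zero] at this

/-- From every chamber, one can reach a chamber in good position for the eigenvalues in `S`. -/
theorem exists_reach_flag [Finite ι] [P.IsCrystallographic] [P.IsReduced] [P.IsRootSystem]
    [FiniteDimensional ℝ E] {b : P.Base} {ρ : D →* P.Aut} (hρ : ActsByIsometries ρ)
    (hD : ∀ d i, b.IsPos (RootPairing.Equiv.indexHom P (ρ d) i) ↔ b.IsPos i)
    (x : ExtWeyl ρ) (S : Finset ℝ)
    (hS : ∀ ν y, symOp ρ x y = ν • y → y ≠ 0 → ν ∉ S → ∀ μ ∈ S, ν < μ) :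
    ∃ (p : E) (g : P.weylGroup), Reach b ρ x g ∧
      (∀ i, b.IsPos i → 0 ≤ inner ℝ (P.root (weylPerm P g i)) p) ∧
      (∀ i, inner ℝ (P.root i) p = 0 ↔
        ∀ ν ∈ S, ∀ y, symOp ρ x y = ν • y → inner ℝ (P.root i) y = 0) ∧
      ∀ ν ∈ S, ∃ e, symOp ρ x e = ν • e ∧ ∀ i, HasLevel (symOp ρ x) (P.root i) ν →
        0 < inner ℝ (P.root i) p * inner ℝ (P.root i) e := by
  -- Eigenvalues enter in decreasing order: the new a lies below S, and `hS` ensures that S already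
  -- contains all eigenvalues above a.
  induction S using Finset.induction_on_min with
  | empty =>
    refine ⟨0, 1, ?_, by simp, by simp, by simp⟩
    rw [Reach, map_one, inv_one, one_mul, mul_one]
    exact Relation.ReflTransGen.refl
  | insert a S haS ih =>
    have hall : ∀ ν > a, ∀ y, symOp ρ x y = ν • y → y ≠ 0 → ν ∈ S := by
      intro ν hν y hy hy0
      by_contra hνS
      exact lt_asymm hν (hS ν y hy hy0 (by simp [hνS, (ne_of_gt hν : ν ≠ a)]) a
        (Finset.mem_insert_self a S))
    obtain ⟨p, g₀, h1, h2, h3, h4⟩ := ih fun ν y hy hy0 hνS μ hμ => by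
      by_cases hνa : ν = a
      · exact hνa ▸ haS μ hμ
      · exact hS ν y hy hy0 (by simp [hνS, hνa]) μ (Finset.mem_insert_of_mem hμ)
    have hp : ∀ i, inner ℝ (P.root i) p = 0 ↔
        ∀ ν > a, ∀ y, symOp ρ x y = ν • y → inner ℝ (P.root i) y = 0 := by
      intro i
      rw [h3]
      refine ⟨fun h ν hν y hy => ?_, fun h ν hν => h ν (haS ν hν)⟩
      by_cases hy0 : y = 0
      · rw [hy0, inner_zero_right]
      · exact h ν (hall ν hν y hy hy0) y hy
    obtain ⟨e, g, he, g1, g2, g3, g4⟩ := exists_reach_eigenvector hρ hD hp h1 h2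
    have t1 : ∀ᶠ t in nhdsWithin (0 : ℝ) (Set.Ioi 0), ∀ i, inner ℝ (P.root i) p ≠ 0 →
        0 < inner ℝ (P.root i) p * inner ℝ (P.root i) p +
          t * (inner ℝ (P.root i) p * inner ℝ (P.root i) e) := by
      refine Filter.eventually_all.2 fun i => ?_
      by_cases hi : inner ℝ (P.root i) p = 0
      · exact Filter.Eventually.of_forall fun t h => absurd hi h
      · exact (eventually_add_mul_pos (Or.inl (mul_self_pos.2 hi))).mono fun t ht _ => ht
    -- For this t, adding t • e keeps the sign of every root not orthogonal to p; e decides only the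
    -- others.
    obtain ⟨t, ht, ht0⟩ := (t1.and self_mem_nhdsWithin).exists
    have htpos : 0 < t := ht0
    have hinner : ∀ i, inner ℝ (P.root i) (p + t • e) =
        inner ℝ (P.root i) p + t * inner ℝ (P.root i) e := fun i => by
      rw [inner_add_right, inner_smul_right]
    have hsign : ∀ i, inner ℝ (P.root i) p ≠ 0 →
        0 < inner ℝ (P.root i) p * inner ℝ (P.root i) (p + t • e) := by
      intro i hi
      have := ht i hi
      rw [hinner]
      linarith
    have hzero : ∀ i, inner ℝ (P.root i) p = 0 →
        inner ℝ (P.root i) (p + t • e) = t * inner ℝ (P.root i) e := by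
      intro i hi
      rw [hinner, hi, zero_add]
    refine ⟨p + t • e, g, g1, fun i hi => ?_, fun i => ⟨fun h => ?_, fun h => ?_⟩, fun ν hν => ?_⟩
    · by_cases h0 : inner ℝ (P.root (weylPerm P g i)) p = 0
      · rw [hzero _ h0]
        exact mul_nonneg htpos.le (g3 i hi h0)
      · exact (pos_of_mul_pos_right (hsign _ h0) (g2 i hi)).le
    · have h0 : inner ℝ (P.root i) p = 0 := by
        by_contra h0
        have := hsign i h0
        rw [h, mul_zero] at this
        exact lt_irrefl _ this
      intro ν hν
      rcases Finset.mem_insert.1 hν with rfl | hν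
      · refine g4 i ?_
        rw [hzero i h0] at h
        exact (mul_eq_zero.1 h).resolve_left htpos.ne'
      · exact (h3 i).1 h0 ν hν
    · rw [hzero i ((h3 i).2 fun ν hν => h ν (Finset.mem_insert_of_mem hν)),
        h a (Finset.mem_insert_self a S) e he, mul_zero]
    · rcases Finset.mem_insert.1 hν with rfl | hν
      · refine ⟨e, he, fun i hi => ?_⟩
        rw [hzero i ((hp i).2 hi.1), mul_assoc]
        refine mul_pos htpos (mul_self_pos.2 fun h0 => ?_)
        obtain ⟨y, hy, hy0⟩ := hi.2
        exact hy0 (g4 i h0 y hy)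
      · obtain ⟨f, hf, hf'⟩ := h4 ν hν
        refine ⟨f, hf, fun i hi => ?_⟩
        have q1 := hf' i hi
        have q2 := hsign i fun h0 => by rw [h0, zero_mul] at q1; exact lt_irrefl _ q1
        have q3 := mul_pos q1 q2
        have q4 : 0 < inner ℝ (P.root i) p ^ 2 *
            (inner ℝ (P.root i) (p + t • e) * inner ℝ (P.root i) f) := by
          linarith [q3]
        exact pos_of_mul_pos_right q4 (sq_nonneg _)

/-- Every element can be brought into good position by cyclic shifts. -/
theorem exists_cyclicShift_isGood [Finite ι] [P.IsCrystallographic] [P.IsReduced] [P.IsRootSystem]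
    [FiniteDimensional ℝ E] {b : P.Base} {ρ : D →* P.Aut} (hρ : ActsByIsometries ρ)
    (hD : ∀ d i, b.IsPos (RootPairing.Equiv.indexHom P (ρ d) i) ↔ b.IsPos i) (x : ExtWeyl ρ) :
    ∃ g : P.weylGroup,
      CyclicShift b ρ x ((SemidirectProduct.inl g)⁻¹ * x * SemidirectProduct.inl g) ∧
      IsGood b ρ ((SemidirectProduct.inl g)⁻¹ * x * SemidirectProduct.inl g) := by
  have hfin : {ν : ℝ | Module.End.HasEigenvalue (symOp ρ x) ν}.Finite :=
    Module.End.finite_hasEigenvalue _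
  have hmem : ∀ ν y, symOp ρ x y = ν • y → y ≠ 0 → ν ∈ hfin.toFinset := fun ν y hy hy0 => by
    rw [Set.Finite.mem_toFinset]
    exact Module.End.hasEigenvalue_of_hasEigenvector
      ⟨Module.End.mem_eigenspace_iff.2 hy, hy0⟩
  obtain ⟨p, g, h1, h2, h3, h4⟩ := exists_reach_flag hρ hD (b := b) x hfin.toFinset
    fun ν y hy hy0 hν => absurd (hmem ν y hy hy0) hν
  refine ⟨g, h1, fun ν => ?_⟩
  by_cases hν : ν ∈ hfin.toFinset
  · obtain ⟨e, he, he'⟩ := h4 ν hν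
    refine ⟨actV ρ (SemidirectProduct.inl g)⁻¹ e, ?_, fun i hi hl => ?_⟩
    · rw [← eigen_conj, actV_inv_actV, he]
    · rw [← hρ.inner_left, ← root_weylPerm ρ]
      rw [← hρ.hasLevel_conj, ← root_weylPerm ρ] at hl
      exact pos_of_mul_pos_right (he' _ hl) (h2 i hi)
  -- When ν is not an eigenvalue, no root has level ν and the zero vector serves.
  · refine ⟨0, by simp, fun i hi hl => ?_⟩
    rw [← hρ.hasLevel_conj] at hl
    obtain ⟨-, y, hy, hy0⟩ := hl
    exact absurd (hmem ν y hy fun h0 => hy0 (by rw [h0, inner_zero_right])) hν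

/-! ### Levels and signs -/

theorem exists_hasLevel [FiniteDimensional ℝ E] {A : E →ₗ[ℝ] E} (hA : A.IsSymmetric) {u : E}
    (hu : u ≠ 0) : ∃ ν, HasLevel A u ν := by
  have hsub : {ν : ℝ | ∃ y, A y = ν • y ∧ inner ℝ u y ≠ 0} ⊆
      {ν : ℝ | Module.End.HasEigenvalue A ν} := by
    rintro ν ⟨y, hy, hy0⟩
    exact Module.End.hasEigenvalue_of_hasEigenvector
      ⟨Module.End.mem_eigenspace_iff.2 hy, fun h0 => hy0 (by rw [h0, inner_zero_right])⟩
  have hne : {ν : ℝ | ∃ y, A y = ν • y ∧ inner ℝ u y ≠ 0}.Nonempty := by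
    by_contra hemp
    rw [Set.not_nonempty_iff_eq_empty, Set.eq_empty_iff_forall_notMem] at hemp
    refine hu ?_
    rw [← inner_self_eq_zero (𝕜 := ℝ), ← (hA.eigenvectorBasis rfl).sum_inner_mul_inner]
    refine Finset.sum_eq_zero fun i _ => ?_
    have : inner ℝ u (hA.eigenvectorBasis rfl i) = 0 := by
      by_contra h0
      exact hemp _ ⟨_, hA.apply_eigenvectorBasis rfl i, h0⟩
    rw [this, zero_mul]
  obtain ⟨ν, hν, hmax⟩ := Set.exists_max_image _ id
    ((Module.End.finite_hasEigenvalue A).subset hsub) hne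
  refine ⟨ν, fun ν' hν' y hy => ?_, hν⟩
  by_contra h0
  exact absurd (hmax ν' ⟨y, hy, h0⟩) (not_le.2 hν')

theorem HasLevel.neg {A : E →ₗ[ℝ] E} {u : E} {ν : ℝ} (h : HasLevel A u ν) :
    HasLevel A (-u) ν := by
  obtain ⟨h1, y, hy, hy0⟩ := h
  refine ⟨fun ν' hν' y hy => ?_, y, hy, ?_⟩
  · rw [inner_neg_left, h1 ν' hν' y hy, neg_zero]
  · rwa [inner_neg_left, neg_ne_zero]

theorem HasLevel.zpow {ρ : D →* P.Aut} (hρ : ActsByIsometries ρ) {x : ExtWeyl ρ} {u : E} {ν : ℝ}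
    (h : HasLevel (symOp ρ x) u ν) (k : ℤ) : HasLevel (symOp ρ x) (actV ρ (x ^ k) u) ν := by
  rw [hρ.hasLevel_conj]
  have : (x ^ k)⁻¹ * x * x ^ k = x := by group
  rwa [this]

theorem isPos_iff_inner_pos {b : P.Base} {ρ : D →* P.Aut} {x : ExtWeyl ρ} {ν : ℝ} {e : E}
    (he : ∀ i, b.IsPos i → HasLevel (symOp ρ x) (P.root i) ν → 0 < inner ℝ (P.root i) e) {i : ι}
    (hi : HasLevel (symOp ρ x) (P.root i) ν) :
    (b.IsPos i ↔ 0 < inner ℝ (P.root i) e) ∧ inner ℝ (P.root i) e ≠ 0 := by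
  by_cases h : b.IsPos i
  · exact ⟨iff_of_true h (he i h hi), (he i h hi).ne'⟩
  · have h1 := he (P.reflectionPerm i i) ((isPos_negIdx b i).2 h) (by
      rw [root_negIdx]; exact hi.neg)
    rw [root_negIdx, inner_neg_left] at h1
    exact ⟨iff_of_false h (by linarith), by linarith⟩

/-- The pairings of `x ^ m • u` with an eigenvector of `x + x⁻¹` satisfy a recurrence. -/
theorem ActsByIsometries.recurrence {ρ : D →* P.Aut} (hρ : ActsByIsometries ρ) {x : ExtWeyl ρ}
    {ν : ℝ} {e : E} (he : symOp ρ x e = ν • e) (u : E) (m : ℕ) :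
    inner ℝ (actV ρ (x ^ (m + 2)) u) e =
      ν * inner ℝ (actV ρ (x ^ (m + 1)) u) e - inner ℝ (actV ρ (x ^ m) u) e := by
  rw [← inner_smul_right, ← he, ← hρ.isSymmetric x, symOp_apply, inner_add_left, ← actV_mul_apply,
    ← actV_mul_apply]
  have e1 : x * x ^ (m + 1) = x ^ (m + 2) := by rw [← pow_succ']
  have e2 : x⁻¹ * x ^ (m + 1) = x ^ m := by rw [pow_succ', inv_mul_cancel_left]
  rw [e1, e2]
  ring

theorem exists_pow_actRoot_eq [Finite ι] (ρ : D →* P.Aut) (x : ExtWeyl ρ) :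
    ∃ n > 0, actRoot ρ (x ^ n) = (1 : Equiv.Perm ι) := by
  obtain ⟨n, hn, h⟩ := isOfFinOrder_iff_pow_eq_one.1
    (isOfFinOrder_of_finite (actRoot ρ x : Equiv.Perm ι))
  exact ⟨n, hn, by rw [map_pow]; exact h⟩

/-- An elliptic element has no eigenvalue `1`, hence `x + x⁻¹` has no eigenvalue `2`. -/
theorem IsElliptic.eq_zero_of_symOp {ρ : D →* P.Aut} (hρ : ActsByIsometries ρ) {x : ExtWeyl ρ}
    (hx : IsElliptic ρ x) {y : E} (hy : symOp ρ x y = (2 : ℝ) • y) : y = 0 := by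
  refine hx y ?_
  have h1 : inner ℝ (symOp ρ x y) y = 2 * inner ℝ y y := by
    rw [hy, inner_smul_left]; simp
  rw [symOp_apply, inner_add_left, hρ.inner_left x⁻¹, inv_inv, real_inner_comm _ y] at h1
  -- Here (xy, y) = (y, y), so ‖xy − y‖² = 2‖y‖² − 2(xy, y) vanishes.
  rw [← sub_eq_zero, ← inner_self_eq_zero (𝕜 := ℝ), inner_sub_left, inner_sub_right,
    inner_sub_right, hρ x, real_inner_comm (actV ρ x y) y]
  have h2 := real_inner_comm (actV ρ x y) y
  linarith

/-! ### Elements in good position are convex -/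

theorem exists_flip [Finite ι] [FiniteDimensional ℝ E] {b : P.Base} {ρ : D →* P.Aut}
    (hρ : ActsByIsometries ρ) {x : ExtWeyl ρ} (hx : IsElliptic ρ x) (hgood : IsGood b ρ x) (i : ι) :
    ∃ k : ℕ, 1 ≤ k ∧ ¬ (b.IsPos (actRoot ρ (x ^ k) i) ↔ b.IsPos i) := by
  have key : ∀ i, b.IsPos i →
      ∃ k : ℕ, 1 ≤ k ∧ ¬ (b.IsPos (actRoot ρ (x ^ k) i) ↔ b.IsPos i) := by
    intro i hi
    by_contra! hcon
    have hpos : ∀ m : ℕ, b.IsPos (actRoot ρ (x ^ m) i) := by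
      intro m
      rcases Nat.eq_zero_or_pos m with rfl | hm
      · rw [pow_zero, map_one]; exact hi
      · exact (hcon m hm).2 hi
    obtain ⟨ν, hν⟩ := exists_hasLevel (hρ.isSymmetric x) (P.ne_zero i)
    obtain ⟨e, he, he'⟩ := hgood ν
    obtain ⟨n, hn, hn1⟩ := exists_pow_actRoot_eq ρ x
    -- Some power of x fixes all roots, so the pairings along the orbit are periodic; staying
    -- positive would force level 2.
    have h2 := recurrence_eq_two
      (a := fun m => inner ℝ (actV ρ (x ^ m) (P.root i)) e) (hρ.recurrence he (P.root i)) hn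
      (fun m => by
      rw [← root_actRoot, ← root_actRoot, pow_add, actRoot_mul_apply, hn1]; rfl) (fun m => by
      have := hν.zpow hρ m
      rw [zpow_natCast, ← root_actRoot] at this
      rw [← root_actRoot]
      exact he' _ (hpos m) this)
    obtain ⟨y, hy, hy0⟩ := hν.2
    rw [h2] at hy
    exact hy0 (by rw [hx.eq_zero_of_symOp hρ hy, inner_zero_right])
  by_cases hi : b.IsPos i
  · exact key i hi
  · obtain ⟨k, hk, h⟩ := key _ ((isPos_negIdx b i).2 hi)
    refine ⟨k, hk, ?_⟩
    rwa [actRoot_negIdx, isPos_negIdx, isPos_negIdx, not_iff_not] at h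

theorem stableRoots_eq_empty [Finite ι] [FiniteDimensional ℝ E] {b : P.Base} {ρ : D →* P.Aut}
    (hρ : ActsByIsometries ρ) {x : ExtWeyl ρ} (hx : IsElliptic ρ x) (hgood : IsGood b ρ x) :
    stableRoots b ρ x = ∅ := by
  rw [Set.eq_empty_iff_forall_notMem]
  intro i hi
  obtain ⟨k, -, hk⟩ := exists_flip hρ hx hgood i
  have h0 : actRoot ρ (x ^ (0 : ℤ)) i = i := by rw [zpow_zero, map_one]; rfl
  rcases hi with hi | hi
  · have h1 := hi k
    have h2 := hi 0
    rw [h0] at h2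
    rw [zpow_natCast] at h1
    exact hk (iff_of_true h1 h2)
  · have h1 := hi k
    have h2 := hi 0
    rw [h0] at h2
    rw [zpow_natCast] at h1
    exact hk (iff_of_false h1 h2)

theorem flipTime_le {b : P.Base} {ρ : D →* P.Aut} {x : ExtWeyl ρ} {i : ι} {k : ℕ} (hk : 1 ≤ k)
    (h : ¬ (b.IsPos (actRoot ρ (x ^ k) i) ↔ b.IsPos i)) : flipTime b ρ x i ≤ k :=
  sInf_le ⟨k, hk, h, rfl⟩

theorem exists_flipTime_eq [Finite ι] [FiniteDimensional ℝ E] {b : P.Base} {ρ : D →* P.Aut}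
    (hρ : ActsByIsometries ρ) {x : ExtWeyl ρ} (hx : IsElliptic ρ x) (hgood : IsGood b ρ x) (i : ι) :
    ∃ k : ℕ, flipTime b ρ x i = k ∧ 1 ≤ k ∧
      ¬ (b.IsPos (actRoot ρ (x ^ k) i) ↔ b.IsPos i) := by
  obtain ⟨k, hk, h⟩ := exists_flip hρ hx hgood i
  obtain ⟨m, h1, h2, h3⟩ := csInf_mem (s := {m : ℕ∞ | ∃ k : ℕ, 1 ≤ k ∧
    ¬ (b.IsPos (actRoot ρ (x ^ k) i) ↔ b.IsPos i) ∧ m = k}) ⟨_, k, hk, h, rfl⟩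
  exact ⟨m, h3, h1, h2⟩

theorem flipTime_add_le_of_isGood [Finite ι] [FiniteDimensional ℝ E] {b : P.Base} {ρ : D →* P.Aut}
    (hρ : ActsByIsometries ρ) {x : ExtWeyl ρ} (hx : IsElliptic ρ x) (hgood : IsGood b ρ x)
    {i j k : ι} (hi : b.IsPos i) (hj : b.IsPos j) (hk : b.IsPos k)
    (hadd : P.root k = P.root i + P.root j) :
    flipTime b ρ x k ≤ max (flipTime b ρ x i) (flipTime b ρ x j) := by
  obtain ⟨p, hp, hp1, hp2⟩ := exists_flipTime_eq hρ hx hgood i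
  obtain ⟨q, hq, hq1, hq2⟩ := exists_flipTime_eq hρ hx hgood j
  obtain ⟨μ, hμ⟩ := exists_hasLevel (hρ.isSymmetric x) (P.ne_zero i)
  obtain ⟨ν, hν⟩ := exists_hasLevel (hρ.isSymmetric x) (P.ne_zero j)
  have hlev : ∀ {l : ι} {κ : ℝ}, HasLevel (symOp ρ x) (P.root l) κ → ∀ m : ℕ,
      HasLevel (symOp ρ x) (P.root (actRoot ρ (x ^ m) l)) κ := by
    intro l κ h m
    have := h.zpow hρ m
    rwa [zpow_natCast, ← root_actRoot] at this
  have hsum : ∀ (m : ℕ) (e : E), inner ℝ (P.root (actRoot ρ (x ^ m) k)) e =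
      inner ℝ (P.root (actRoot ρ (x ^ m) i)) e + inner ℝ (P.root (actRoot ρ (x ^ m) j)) e := by
    intro m e
    rw [root_actRoot, root_actRoot, root_actRoot, hadd, map_add, inner_add_left]
  have hsum0 : ∀ e : E, inner ℝ (P.root k) e = inner ℝ (P.root i) e + inner ℝ (P.root j) e := by
    intro e
    rw [hadd, inner_add_left]
  -- Unequal levels: the lower root is orthogonal to the μ-eigenspace along its whole orbit, so the
  -- sum always has the sign of the higher one.
  have hup : ∀ {i j : ι} {μ ν : ℝ}, HasLevel (symOp ρ x) (P.root i) μ →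
      HasLevel (symOp ρ x) (P.root j) ν → ν < μ → b.IsPos i →
      (∀ (m : ℕ) (e : E), inner ℝ (P.root (actRoot ρ (x ^ m) k)) e =
        inner ℝ (P.root (actRoot ρ (x ^ m) i)) e + inner ℝ (P.root (actRoot ρ (x ^ m) j)) e) →
      (∀ e : E, inner ℝ (P.root k) e = inner ℝ (P.root i) e + inner ℝ (P.root j) e) →
      ∀ p : ℕ, 1 ≤ p → ¬ (b.IsPos (actRoot ρ (x ^ p) i) ↔ b.IsPos i) →
      flipTime b ρ x k ≤ p := by
    intro i j μ ν hμ hν hlt hi hsum hsum0 p hp1 hp2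
    obtain ⟨e, he, he'⟩ := hgood μ
    have hkμ : HasLevel (symOp ρ x) (P.root k) μ := by
      obtain ⟨h1, y, hy, hy0⟩ := hμ
      refine ⟨fun κ hκ y hy => ?_, y, hy, ?_⟩
      · rw [hsum0, h1 κ hκ y hy, hν.1 κ (hlt.trans hκ) y hy, add_zero]
      · rwa [hsum0, hν.1 μ hlt y hy, add_zero]
    refine flipTime_le hp1 fun h => hp2 ?_
    rw [(isPos_iff_inner_pos he' (hlev hkμ p)).1, hsum, (hlev hν p).1 μ hlt e he, add_zero,
      ← (isPos_iff_inner_pos he' (hlev hμ p)).1] at h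
    exact iff_of_true (h.2 hk) hi
  rw [hp, hq]
  rcases lt_trichotomy μ ν with hlt | rfl | hlt
  · exact (hup hν hμ hlt hj (fun m e => by rw [hsum, add_comm]) (fun e => by rw [hsum0, add_comm])
      q hq1 hq2).trans (le_max_right _ _)
  · obtain ⟨e, he, he'⟩ := hgood μ
    have hkμ : HasLevel (symOp ρ x) (P.root k) μ := by
      refine ⟨fun κ hκ y hy => ?_, e, he, ?_⟩
      · rw [hsum0, hμ.1 κ hκ y hy, hν.1 κ hκ y hy, add_zero]
      · rw [hsum0]
        exact (add_pos (he' i hi hμ) (he' j hj hν)).ne'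
    have hnon : ∀ {l : ι} {m : ℕ}, b.IsPos l → HasLevel (symOp ρ x) (P.root l) μ →
        ¬ (b.IsPos (actRoot ρ (x ^ m) l) ↔ b.IsPos l) →
        inner ℝ (actV ρ (x ^ m) (P.root l)) e ≤ 0 := by
      intro l m hl hlμ h
      rw [← root_actRoot, ← not_lt, ← (isPos_iff_inner_pos he' (hlev hlμ m)).1]
      exact fun h' => h (iff_of_true h' hl)
    have hzero : ∀ {l : ι}, b.IsPos l → HasLevel (symOp ρ x) (P.root l) μ →
        0 < inner ℝ (actV ρ (x ^ 0) (P.root l)) e := by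
      intro l hl hlμ
      rw [pow_zero, map_one]
      exact he' l hl hlμ
    obtain ⟨m, hm, hm0⟩ := exists_nonpos_of_add
      (a := fun m => inner ℝ (actV ρ (x ^ m) (P.root i)) e)
      (c := fun m => inner ℝ (actV ρ (x ^ m) (P.root j)) e) (hρ.recurrence he (P.root i))
      (hρ.recurrence he (P.root j)) (hnon hi hμ hp2) (hnon hj hν hq2) (hzero hi hμ) (hzero hj hν)
    have hm1 : 1 ≤ m := by
      rcases Nat.eq_zero_or_pos m with rfl | hm1
      · exact absurd (add_pos (hzero hi hμ) (hzero hj hν)) (not_lt.2 hm0)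
      · exact hm1
    refine (flipTime_le hm1 fun h => ?_).trans (by
      rw [le_max_iff] at hm ⊢
      exact_mod_cast hm)
    have h1 := (isPos_iff_inner_pos he' (hlev hkμ m)).1.1 (h.2 hk)
    rw [hsum, root_actRoot, root_actRoot] at h1
    linarith
  · exact (hup hμ hν hlt hi hsum hsum0 p hp1 hp2).trans (le_max_left _ _)

theorem isQuasiConvex_of_isGood [Finite ι] [FiniteDimensional ℝ E] {b : P.Base} {ρ : D →* P.Aut}
    (hρ : ActsByIsometries ρ) {x : ExtWeyl ρ} (hx : IsElliptic ρ x) (hgood : IsGood b ρ x) :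
    IsQuasiConvex b ρ x where
  parabolic := by
    refine ⟨∅, Set.empty_subset _, ?_⟩
    rw [stableRoots_eq_empty hρ hx hgood, eq_comm, Set.eq_empty_iff_forall_notMem]
    intro i hi
    simp only [Set.image_empty, Submodule.span_empty, Set.mem_ofPred_eq, Submodule.mem_bot] at hi
    exact P.ne_zero i hi
  flipTime_add_le _ _ _ hi hj hk hadd := flipTime_add_le_of_isGood hρ hx hgood hi hj hk hadd

/-- Both ellipticity and good position are invariant under inversion. -/
theorem isConvex_of_isGood [Finite ι] [FiniteDimensional ℝ E] {b : P.Base} {ρ : D →* P.Aut}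
    (hρ : ActsByIsometries ρ) {x : ExtWeyl ρ} (hx : IsElliptic ρ x) (hgood : IsGood b ρ x) :
    IsConvex b ρ x := by
  refine ⟨isQuasiConvex_of_isGood hρ hx hgood, isQuasiConvex_of_isGood hρ (fun v hv => hx v ?_) ?_⟩
  · nth_rewrite 1 [← hv]
    exact actV_inv_actV ρ x v
  · intro ν
    rw [symOp_inv]
    exact hgood ν

/-! ### The length of an element in good position -/

theorem ActsByIsometries.norm_actV {ρ : D →* P.Aut} (hρ : ActsByIsometries ρ) (x : ExtWeyl ρ)
    (v : E) : ‖actV ρ x v‖ = ‖v‖ := by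
  rw [norm_eq_sqrt_real_inner, norm_eq_sqrt_real_inner, hρ]

theorem ActsByIsometries.abs_eigenvalue_le {ρ : D →* P.Aut} (hρ : ActsByIsometries ρ)
    {x : ExtWeyl ρ} {ν : ℝ} {y : E} (hy : symOp ρ x y = ν • y) (hy0 : y ≠ 0) : |ν| ≤ 2 := by
  have h1 : ‖symOp ρ x y‖ ≤ 2 * ‖y‖ := by
    rw [symOp_apply]
    refine (norm_add_le _ _).trans ?_
    rw [hρ.norm_actV, hρ.norm_actV, two_mul]
  rw [hy, norm_smul, Real.norm_eq_abs] at h1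
  exact le_of_mul_le_mul_right h1 (norm_pos_iff.2 hy0)

theorem ActsByIsometries.actV_eq_neg {ρ : D →* P.Aut} (hρ : ActsByIsometries ρ)
    {x : ExtWeyl ρ} {y : E} (hy : symOp ρ x y = (-2 : ℝ) • y) : actV ρ x y = -y := by
  have h1 : inner ℝ (symOp ρ x y) y = -2 * inner ℝ y y := by
    rw [hy, inner_smul_left]; simp
  rw [symOp_apply, inner_add_left, hρ.inner_left x⁻¹, inv_inv, real_inner_comm _ y] at h1
  rw [eq_neg_iff_add_eq_zero, ← inner_self_eq_zero (𝕜 := ℝ), inner_add_left, inner_add_right,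
    inner_add_right, hρ x, real_inner_comm (actV ρ x y) y]
  have h2 := real_inner_comm (actV ρ x y) y
  linarith

/-- The pairings of `x ^ m • u` with an eigenvector of `x + x⁻¹` trace out a cosine. -/
theorem ActsByIsometries.exists_cos_form {ρ : D →* P.Aut} (hρ : ActsByIsometries ρ)
    {x : ExtWeyl ρ} (hx : IsElliptic ρ x) {ν : ℝ} {e : E} (he : symOp ρ x e = ν • e) (he0 : e ≠ 0)
    (u : E) :
    ∃ r φ : ℝ, 0 ≤ r ∧ ∀ m : ℕ, inner ℝ (actV ρ (x ^ m) u) e =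
      r * Real.cos (φ + m * Real.arccos (ν / 2)) := by
  have hν := abs_le.1 (hρ.abs_eigenvalue_le he he0)
  have hcos : Real.cos (Real.arccos (ν / 2)) = ν / 2 :=
    Real.cos_arccos (by linarith) (by linarith)
  have hν2 : ν ≠ 2 := fun h => he0 (hx.eq_zero_of_symOp hρ (h ▸ he))
  -- At ν = −2 the step is π and sin θ = 0, so the general formula fails; there x acts on e as −1
  -- and the sequence alternates.
  by_cases hν' : ν = -2
  · have harc : Real.arccos (ν / 2) = Real.pi := by
      rw [hν', show (-2 : ℝ) / 2 = -1 by norm_num, Real.arccos_neg_one]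
    rw [hν'] at he
    have hinv : actV ρ x⁻¹ e = -e := by
      have := hρ.actV_eq_neg (x := x⁻¹) (by rw [symOp_inv]; exact he)
      exact this
    have hseq : ∀ m : ℕ, inner ℝ (actV ρ (x ^ m) u) e = (-1) ^ m * inner ℝ u e := by
      intro m
      induction m with
      | zero => simp
      | succ m ih =>
        rw [pow_succ', actV_mul_apply, hρ.inner_left, hinv, inner_neg_right, ih, pow_succ]
        ring
    rcases le_total 0 (inner ℝ u e) with h | h
    · refine ⟨inner ℝ u e, 0, h, fun m => ?_⟩
      rw [hseq, harc, zero_add, Real.cos_nat_mul_pi, mul_comm]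
    · refine ⟨-inner ℝ u e, Real.pi, by linarith, fun m => ?_⟩
      rw [hseq, harc, add_comm, Real.cos_add_pi, Real.cos_nat_mul_pi]
      ring
  · refine ConvexElements.exists_cos_form (a := fun m => inner ℝ (actV ρ (x ^ m) u) e) ?_ ?_
    · rw [Real.sin_arccos]
      refine (Real.sqrt_pos.2 ?_).ne'
      have h1 : ν < 2 := lt_of_le_of_ne hν.2 hν2
      have h2 : -2 < ν := lt_of_le_of_ne hν.1 (Ne.symm hν')
      nlinarith
    · intro m
      rw [hcos]
      have := hρ.recurrence he u m
      rw [this]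
      ring

open Classical in
/-- The number of sign changes of an element in good position is determined by the levels. -/
theorem signChanges_eq_sum [Fintype ι] [FiniteDimensional ℝ E] {b : P.Base} {ρ : D →* P.Aut}
    (hρ : ActsByIsometries ρ) {x : ExtWeyl ρ} (hx : IsElliptic ρ x) (hgood : IsGood b ρ x)
    (ν : ι → ℝ) (hν : ∀ i, HasLevel (symOp ρ x) (P.root i) (ν i)) :
    (signChanges b (actRoot ρ x) : ℝ) = ∑ i, Real.arccos (ν i / 2) / Real.pi := by
  set f : ι → ℝ := fun i => if (b.IsPos (actRoot ρ x i) ↔ b.IsPos i) then 0 else 1 with hf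
  have hT : (signChanges b (actRoot ρ x) : ℝ) = ∑ i, f i := by
    rw [signChanges, Set.ncard_eq_toFinset_card', hf]
    simp only [← ite_not (p := (_ ↔ _))]
    rw [Finset.sum_boole]
    congr 2
    ext i
    simp
  have hshift : ∀ m : ℕ, ∑ i, f (actRoot ρ (x ^ m) i) = ∑ i, f i := fun m =>
    Equiv.sum_comp (actRoot ρ (x ^ m)) f
  have hbound : ∀ (i : ι) (q : ℕ),
      |∑ m ∈ Finset.range q, f (actRoot ρ (x ^ m) i) - q * (Real.arccos (ν i / 2) / Real.pi)| ≤ 1 := by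
    intro i q
    obtain ⟨e, he, he'⟩ := hgood (ν i)
    have hlev : ∀ m : ℕ, HasLevel (symOp ρ x) (P.root (actRoot ρ (x ^ m) i)) (ν i) := by
      intro m
      have := (hν i).zpow hρ m
      rwa [zpow_natCast, ← root_actRoot] at this
    have hsign := fun m => isPos_iff_inner_pos he' (hlev m)
    have he0 : e ≠ 0 := fun h0 => (hsign 0).2 (by rw [h0, inner_zero_right])
    obtain ⟨r, φ, hr, hcos⟩ := hρ.exists_cos_form hx he he0 (P.root i)
    have := card_sign_changes_bound (Real.arccos_nonneg (ν i / 2)) (Real.arccos_le_pi _) r φ hr hcos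
      (fun m => by rw [← root_actRoot]; exact (hsign m).2) q
    convert this using 4 with m hm
    rw [hf]
    simp only [← actRoot_mul_apply, ← pow_succ', ← root_actRoot, (hsign _).1]
  -- Since x permutes the roots, q steps see q times the sign changes of one step, while the total
  -- error is at most 1 per root. Letting q grow forces equality.
  have hq : ∀ q : ℕ, |(q : ℝ) * ((∑ i, f i) - ∑ i, Real.arccos (ν i / 2) / Real.pi)| ≤
      Fintype.card ι := by
    intro q
    have h1 : (q : ℝ) * ∑ i, f i = ∑ i, ∑ m ∈ Finset.range q, f (actRoot ρ (x ^ m) i) := by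
      rw [Finset.sum_comm, Finset.sum_congr rfl fun m _ => hshift m]
      simp
    rw [mul_sub, h1, Finset.mul_sum, ← Finset.sum_sub_distrib]
    refine (Finset.abs_sum_le_sum_abs _ _).trans ?_
    refine (Finset.sum_le_sum fun i _ => hbound i q).trans ?_
    simp
  rw [hT, ← sub_eq_zero]
  by_contra h0
  obtain ⟨q, hq'⟩ := exists_nat_gt ((Fintype.card ι : ℝ) /
    |(∑ i, f i) - ∑ i, Real.arccos (ν i / 2) / Real.pi|)
  rw [div_lt_iff₀ (abs_pos.2 h0)] at hq'
  have := hq q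
  rw [abs_mul, Nat.abs_cast] at this
  linarith

/-- The level of a root for the conjugate is the level of its g-image for x, so the sum of angles is
only reindexed. -/
theorem signChanges_conj_eq [Finite ι] [FiniteDimensional ℝ E] {b : P.Base} {ρ : D →* P.Aut}
    (hρ : ActsByIsometries ρ) {x g : ExtWeyl ρ} (hx : IsElliptic ρ x) (hgood : IsGood b ρ x)
    (hx' : IsElliptic ρ (g⁻¹ * x * g)) (hgood' : IsGood b ρ (g⁻¹ * x * g)) :
    signChanges b (actRoot ρ (g⁻¹ * x * g)) = signChanges b (actRoot ρ x) := by
  have := Fintype.ofFinite ι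
  choose ν hν using fun i => exists_hasLevel (hρ.isSymmetric x) (P.ne_zero i)
  have h1 := signChanges_eq_sum hρ hx hgood ν hν
  have h2 := signChanges_eq_sum hρ hx' hgood' (fun i => ν (actRoot ρ g i)) fun i => by
    rw [← hρ.hasLevel_conj, ← root_actRoot]
    exact hν _
  rw [Equiv.sum_comp (actRoot ρ g) (fun i => Real.arccos (ν i / 2) / Real.pi), ← h1] at h2
  exact_mod_cast h2

theorem CyclicShift.length_le {b : P.Base} {ρ : D →* P.Aut} {x y : ExtWeyl ρ}
    (h : CyclicShift b ρ x y) : length b ρ y ≤ length b ρ x := by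
  induction h with
  | refl => exact le_rfl
  | tail _ hs ih =>
    obtain ⟨i, -, -, h⟩ := hs
    exact h.trans ih

/-- The main result when `V` carries an invariant inner product. -/
theorem exists_convex_minLength [Finite ι] [P.IsCrystallographic] [P.IsReduced] [P.IsRootSystem]
    [FiniteDimensional ℝ E] {b : P.Base} {ρ : D →* P.Aut} (hρ : ActsByIsometries ρ)
    (hD : ∀ d i, b.IsPos (RootPairing.Equiv.indexHom P (ρ d) i) ↔ b.IsPos i)
    {O : Set (ExtWeyl ρ)} (hO : IsWConjClass ρ O) (hell : ∀ x ∈ O, IsElliptic ρ x) :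
    ∀ x ∈ O, ∃ x' ∈ minLength b ρ O, IsConvex b ρ x' ∧ CyclicShift b ρ x x' := by
  obtain ⟨x₀, rfl⟩ := hO
  have hconj : ∀ {x : ExtWeyl ρ} (g : P.weylGroup),
      (∃ w : P.weylGroup, x = SemidirectProduct.inl w * x₀ * (SemidirectProduct.inl w)⁻¹) →
      ∃ w : P.weylGroup, (SemidirectProduct.inl g)⁻¹ * x * SemidirectProduct.inl g =
        SemidirectProduct.inl w * x₀ * (SemidirectProduct.inl w)⁻¹ := by
    rintro _ g ⟨w, rfl⟩
    refine ⟨g⁻¹ * w, ?_⟩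
    rw [map_mul, map_inv]
    group
  intro x hxO
  obtain ⟨g, h1, h2⟩ := exists_cyclicShift_isGood (b := b) hρ hD x
  have hx' := hconj g hxO
  refine ⟨_, ⟨hx', fun z hz => ?_⟩, isConvex_of_isGood hρ (hell _ hx') h2, h1⟩
  -- Any competitor z descends to a good element of the same class, which has the same length as the
  -- one reached from x.
  obtain ⟨k, h3, h4⟩ := exists_cyclicShift_isGood (b := b) hρ hD z
  have hz' := hconj k hz
  refine le_trans (le_of_eq ?_) h3.length_le
  obtain ⟨w, hw⟩ := hx'
  obtain ⟨w', hw'⟩ := hz'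
  have hrel : (SemidirectProduct.inl k)⁻¹ * z * SemidirectProduct.inl k =
      ((SemidirectProduct.inl w : ExtWeyl ρ) * (SemidirectProduct.inl w')⁻¹)⁻¹ *
        ((SemidirectProduct.inl g)⁻¹ * x * SemidirectProduct.inl g) *
        ((SemidirectProduct.inl w : ExtWeyl ρ) * (SemidirectProduct.inl w')⁻¹) := by
    rw [hw, hw']
    group
  have e1 := two_mul_length b ρ hD ((SemidirectProduct.inl g)⁻¹ * x * SemidirectProduct.inl g)
  have e2 := two_mul_length b ρ hD ((SemidirectProduct.inl k)⁻¹ * z * SemidirectProduct.inl k)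
  have e3 := hell _ (hconj k hz)
  rw [hrel] at e2 e3 h4 ⊢
  have e4 := signChanges_conj_eq hρ (hell _ (hconj g hxO)) h2 e3 h4
  omega

/-! ### The invariant inner product -/

section RootForm

variable {V : Type v} [AddCommGroup V] [Module ℝ V] {Q : RootPairing ι ℝ V N}

/-- The form is a sum over all coroots, which an automorphism permutes compatibly with the pairing.
-/
theorem rootForm_weightMap [Fintype ι] (f : Q.Aut) (u v : V) :
    Q.RootForm (f.weightMap u) (f.weightMap v) = Q.RootForm u v := by
  rw [RootPairing.rootForm_apply_apply, RootPairing.rootForm_apply_apply]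
  have h : ∀ i w, Q.coroot' (f.indexEquiv i) (f.weightMap w) = Q.coroot' i w := by
    intro i w
    have h2 : f.coweightMap (Q.coroot (f.indexEquiv i)) = Q.coroot i := by
      simpa using RootPairing.Hom.coroot_coweightMap_apply Q Q (f.indexEquiv i) f.toHom
    change Q.toLinearMap (f.weightMap w) (Q.coroot (f.indexEquiv i)) =
      Q.toLinearMap w (Q.coroot i)
    rw [← h2]
    exact LinearMap.congr_fun (RootPairing.Hom.weight_coweight_transpose_apply Q Q
      (Q.coroot (f.indexEquiv i)) f.toHom) w
  rw [← Equiv.sum_comp f.indexEquiv]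
  exact Finset.sum_congr rfl fun i _ => by rw [h, h]

theorem eq_zero_of_rootForm_self [Fintype ι] [Q.IsRootSystem] {v : V} (h : Q.RootForm v v = 0) :
    v = 0 := by
  rw [RootPairing.rootForm_apply_apply,
    Finset.sum_eq_zero_iff_of_nonneg fun i _ => mul_self_nonneg _] at h
  have h1 : Q.toLinearMap v = 0 := by
    refine LinearMap.ext_on_range (v := Q.coroot) RootPairing.IsRootSystem.span_coroot_eq_top
      fun i => ?_
    exact mul_self_eq_zero.1 (h i (Finset.mem_univ i))
  have hinj := (LinearMap.IsPerfPair.bijective_left Q.toLinearMap).injective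
  exact hinj (by rw [h1, map_zero])

/-- The root form is an inner product. -/
abbrev rootFormCore (Q : RootPairing ι ℝ V N) [Fintype ι] [Q.IsRootSystem] :
    InnerProductSpace.Core ℝ V where
  inner u v := Q.RootForm u v
  conj_inner_symm u v := by
    simpa using Q.rootForm_symmetric.eq v u
  re_inner_nonneg v := by
    rw [RootPairing.rootForm_apply_apply]
    exact Finset.sum_nonneg fun i _ => mul_self_nonneg _
  add_left u v w := by simp
  smul_left u v r := by simp
  definite v h := eq_zero_of_rootForm_self h

end RootForm

end ConvexElements

end

/-! ### Transfer to an abstract root system -/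

theorem mainTheorem6 {ι : Type*} {V : Type*} {N : Type*} {D : Type*} [Finite ι]
    [AddCommGroup V] [Module ℝ V] [AddCommGroup N] [Module ℝ N] [Group D]
    (P : RootPairing ι ℝ V N) [P.IsRootSystem] [P.IsCrystallographic] [P.IsReduced]
    (b : P.Base) (ρ : D →* P.Aut) (δ : D)
    (hgen : Subgroup.zpowers δ = ⊤)
    (hδ : ∀ i, b.IsPos i → b.IsPos (RootPairing.Equiv.indexHom P (ρ δ) i))
    (O : Set (ConvexElements.ExtWeyl ρ)) (hO : ConvexElements.IsWConjClass ρ O)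
    (hell : ∀ x ∈ O, ConvexElements.IsElliptic ρ x) :
    ∀ x ∈ O, ∃ x' ∈ ConvexElements.minLength b ρ O,
      ConvexElements.IsConvex b ρ x' ∧ ConvexElements.CyclicShift b ρ x x' := by
  have := Fintype.ofFinite ι
  have : FiniteDimensional ℝ V := b.toWeightBasis.finiteDimensional_of_finite
  -- The Euclidean structure is built from the root form itself, so its inner product unfolds to
  -- `RootForm` and `hρ` is exactly invariance of that form.
  let core : InnerProductSpace.Core ℝ V := ConvexElements.rootFormCore P
  let : NormedAddCommGroup V := core.toNormedAddCommGroup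
  let : InnerProductSpace ℝ V := InnerProductSpace.ofCore core.toCore
  have hρ : ConvexElements.ActsByIsometries ρ := fun x u v =>
    ConvexElements.rootForm_weightMap (ConvexElements.toAut ρ x) u v
  exact ConvexElements.exists_convex_minLength hρ
    (ConvexElements.isPos_iff_of_generator b ρ δ hgen hδ) hO hell
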